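/- Let $m\ge 2$ and let $$x_{t+1}=Fx_t+Bu_t+w_t,\qquad y_t=Hx_t+v_t\qquad(t\ge 0)$$ be an $m$-dimensional system with scalar measurements in observable canonical form: the first column of $F\in\mathbb R^{m\times m}$ is $(-a_1,\dots,-a_m)^T$, its superdiagonal entries are $1$, all its other entries are $0$, and $H=[1,0,\dots,0]$. For a square matrix $A$ let $\lambda(A)$ be the largest modulus of an eigenvalue of $A$, and let $|F|$ be the entrywise absolute value of $F$. Assume $\lambda(F)>1$. The initial state and the noises are bounded random variables, $\|x_0\|_\infty\le X_0$, $\|w_t\|_\infty<W/2$, $|v_t|<V/2$, with known bounds $X_0,W,V$. One time step corresponds to $n\ge 1$ uses of a noisy binary-input channel without feedback, whose noise is independent of $(x_0,(w_t),(v_t))$. At time $t$ an observer forms a $k$-bit message $b_t$, a causal encoder maps $b_0,\dots,b_t$ to $n$ channel inputs, and a decoder computes from the channel outputs up to time $t$ estimates $\hat b_{\tau|t}$ of $b_\tau$, $\tau\le t$. The encoder-decoder pair is $(R,\beta)$-anytime reliable if $k=nR$ and there are $d_o>0$ and $\eta>0$ such that, for every message sequence, $$P\bigl(\min\{\tau:\hat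 b_{\tau|t}\ne b_\tau\}=t-d+1\bigr)\le\eta\,2^{-n\beta d}\qquad\text{for all } t \text{ and all } d\ge d_o .$$ The observer knows the control inputs: $b_t$ may depend on $y_0,\dots,y_t$ and on the control inputs applied before time $t$. The control input $u_{t+1}$ is a function of the estimates $\hat b_{\tau|s}$, $\tau\le s\le t$, and $u_0$ is a constant. Let $\theta=\frac{m}{m-1}$, $D_{m,nr}=\mathrm{diag}(\sqrt m\,2^{-nr},\sqrt\theta,\dots,\sqrt\theta)$ and $$R^f_{e,n}=\inf\{r\in\mathbb R:\lambda(|F|\,D_{m,nr})<1\},\qquad \beta^f_{e,n}=\frac2n\log_2\lambda(F).$$ If $(F,B)$ is controllable, $R>R^f_{e,n}$ and $\beta>\beta^f_{e,n}$, then the system can be stabilized in the mean-square sense with any $(R,\beta)$-anytime reliable encoder-decoder pair: there are an observer and a controller such that $\limsup_{t\to\infty}\mathbb E\|x_t\|^2<\infty$ for all noises as above. Moreover, the infimum $R^f_{e,n}$ is finite, and $$R^f_{e,n}\le\frac1{2n}\log_2 m+\frac1n\log_2\max\Bigl\{|a_m|(2\theta)^{m-1},\ \max_{1\le i\le m-1}2|a_i|(2\theta)^{i-1}\Bigr\}.$$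 -/

import Mathlib

open MeasureTheory ProbabilityTheory Filter
open scoped Matrix

/-! ### The plant -/

/-- The system matrix in observable canonical form: first column `(-a₁, …, -a_m)`, ones on the
superdiagonal, zeros elsewhere. Only the values `a 1, …, a m` are used. -/
def plantMatrix (m : ℕ) (a : ℕ → ℝ) : Matrix (Fin m) (Fin m) ℝ :=
  Matrix.of fun i j =>
    if (j : ℕ) = 0 then -a (i + 1) else if (j : ℕ) = i + 1 then 1 else 0

/-- The measurement row `H = [1, 0, …, 0]`. -/
def outputRow (m : ℕ) : Fin m → ℝ := fun j => if (j : ℕ) = 0 then 1 else 0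

/-- `λ(A)`: the largest modulus of a (complex) eigenvalue of the real square matrix `A`. -/
noncomputable def specRad {m : ℕ} (A : Matrix (Fin m) (Fin m) ℝ) : ℝ :=
  (spectralRadius ℂ (A.map (algebraMap ℝ ℂ))).toReal

/-- The entrywise absolute value of a matrix. -/
def absMatrix {m : ℕ} (A : Matrix (Fin m) (Fin m) ℝ) : Matrix (Fin m) (Fin m) ℝ :=
  A.map fun x => |x|

/-- `(F, B)` is controllable: `[B, FB, …, F^{m-1}B]` has rank `m`. -/
def IsControllable {m p : ℕ} (F : Matrix (Fin m) (Fin m) ℝ) (B : Matrix (Fin m) (Fin p) ℝ) :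
    Prop :=
  (Matrix.of fun (i : Fin m) (j : Fin m × Fin p) => (F ^ (j.1 : ℕ) * B) i j.2).rank = m

/-! ### The rate threshold -/

/-- `θ = m / (m - 1)` (used for `m ≥ 2`). -/
noncomputable def theta (m : ℕ) : ℝ := (m : ℝ) / ((m : ℝ) - 1)

/-- `diag(√m 2^{-nr}, √θ, …, √θ)`. -/
noncomputable def scalingMatrix (m n : ℕ) (r : ℝ) : Matrix (Fin m) (Fin m) ℝ :=
  Matrix.diagonal fun i =>
    if (i : ℕ) = 0 then √(m : ℝ) * (2 : ℝ) ^ (-((n : ℝ) * r)) else √(theta m)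

/-- The set of all `r` with `λ(|F| diag(√m 2^{-nr}, √θ, …, √θ)) < 1`. -/
def admissibleRates {m : ℕ} (n : ℕ) (F : Matrix (Fin m) (Fin m) ℝ) : Set ℝ :=
  {r | specRad (absMatrix F * scalingMatrix m n r) < 1}

/-- The rate threshold: the infimum of the admissible rates. -/
noncomputable def rateThreshold {m : ℕ} (n : ℕ) (F : Matrix (Fin m) (Fin m) ℝ) : ℝ :=
  sInf (admissibleRates n F)

/-! ### Channel, code, observer, controller

Blocks of `k` source bits are `Fin k → Bool`, blocks of `n` channel inputs are `Fin n → Bool`,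
blocks of `n` channel outputs are `Fin n → Z`. A string indexed by the times `0, …, t` is a
function on `Fin (t + 1)`. -/

/-- A noisy channel with binary inputs, output alphabet `Z`, used `n` times per time step, without
feedback: the outputs of step `t` are a function of the inputs of the steps `0, …, t` and of a
random channel noise with law `noise`. A memoryless channel with transition laws `κ 0`, `κ 1` is
the case where the noise is a family of independent variables `ζ (t, i, c)` with law `κ c`, and
the `i`-th output at time `t` under the input `c` is `ζ (t, i, c)`. -/
structure Channel (n : ℕ) (Z N : Type*) [MeasurableSpace Z] [MeasurableSpace N] where
  noise : Measure N
  isProbabilityMeasure : IsProbabilityMeasure noise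
  out : (t : ℕ) → (Fin (t + 1) → Fin n → Bool) → N → Fin n → Z
  measurable_out : ∀ t c, Measurable (out t c)

/-- A causal encoder-decoder pair: the encoder maps the messages `b_0, …, b_t` to the channel
inputs `c_t`; the decoder maps the channel outputs `z_0, …, z_t` to the estimates `b̂_{τ|t}`,
`τ ≤ t`. -/
structure CausalCode (n k : ℕ) (Z : Type*) [MeasurableSpace Z] where
  enc : (t : ℕ) → (Fin (t + 1) → Fin k → Bool) → Fin n → Bool
  dec : (t : ℕ) → (Fin (t + 1) → Fin n → Z) → Fin (t + 1) → Fin k → Bool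
  measurable_dec : ∀ t, Measurable (dec t)

section Reliability

variable {n k : ℕ} {Z N : Type*} [MeasurableSpace Z] [MeasurableSpace N]

/-- The channel outputs at time `t` when the messages are `b` and the channel noise is `ν`. -/
def channelOutput (ch : Channel n Z N) (code : CausalCode n k Z) (b : ℕ → Fin k → Bool) (ν : N)
    (t : ℕ) : Fin n → Z :=
  ch.out t (fun s => code.enc s fun q => b q) ν

/-- The estimates `b̂_{τ|t}`, `τ ≤ t`, when the messages are `b` and the channel noise is `ν`. -/
def decodedBits (ch : Channel n Z N) (code : CausalCode n k Z) (b : ℕ → Fin k → Bool) (ν : N)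
    (t : ℕ) : Fin (t + 1) → Fin k → Bool :=
  code.dec t fun s => channelOutput ch code b ν s

/-- `(R, β)`-anytime reliability: the code has rate `R = k / n`, and for some `η > 0` and some
delay `d₀ > 0`, whatever the message sequence is, the probability that the earliest decoding error
at time `t` concerns time `t - d + 1` is at most `η 2^{-nβd}`, for all `t` and all `d ≥ d₀`
(with `t - d + 1 ≥ 0`). -/
def IsAnytimeReliable (ch : Channel n Z N) (code : CausalCode n k Z) (R β : ℝ) : Prop :=
  (k : ℝ) = n * R ∧
  ∃ d₀ : ℕ, 0 < d₀ ∧ ∃ η : ℝ, 0 < η ∧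
    ∀ (b : ℕ → Fin k → Bool) (t d : ℕ), d₀ ≤ d → d ≤ t + 1 →
      ch.noise {ν | IsLeast {τ : ℕ | ∃ h : τ < t + 1, decodedBits ch code b ν t ⟨τ, h⟩ ≠ b τ}
          (t + 1 - d)} ≤
        ENNReal.ofReal (η * (2 : ℝ) ^ (-((n : ℝ) * β * d)))

end Reliability

/-- An observer that knows the control inputs: its `k`-bit message at time `t` is a (measurable)
function of the measurements `y_0, …, y_t` and of the control inputs `u_0, …, u_{t-1}` applied
before. -/
structure InformedObserver (p k : ℕ) where
  msg : (t : ℕ) → (Fin (t + 1) → ℝ) → (Fin t → Fin p → ℝ) → Fin k → Bool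
  measurable_msg : ∀ t, Measurable fun q : (Fin (t + 1) → ℝ) × (Fin t → Fin p → ℝ) =>
    msg t q.1 q.2

/-- A controller: the control input `u_{t+1}` is a function of what the decoder has produced at the
times `0, …, t`; `u_0` is a constant. -/
structure Controller (p k : ℕ) where
  init : Fin p → ℝ
  law : (t : ℕ) → ((s : Fin (t + 1)) → Fin (s + 1) → Fin k → Bool) → Fin p → ℝ

/-- `x` (states), `y` (measurements), `b` (messages), `bh` (decoder outputs) and `u` (control
inputs) are the signals of the closed loop for the initial state `x₀`, the process noise `w`, the
measurement noise `v` and the channel noise `ν`. These equations determine the signals uniquely,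
recursively in time. -/
structure IsClosedLoop {m p n k : ℕ} {Z N : Type*} [MeasurableSpace Z] [MeasurableSpace N]
    (F : Matrix (Fin m) (Fin m) ℝ) (B : Matrix (Fin m) (Fin p) ℝ)
    (ch : Channel n Z N) (code : CausalCode n k Z)
    (obs : InformedObserver p k) (ctl : Controller p k)
    (x₀ : Fin m → ℝ) (w : ℕ → Fin m → ℝ) (v : ℕ → ℝ) (ν : N)
    (x : ℕ → Fin m → ℝ) (y : ℕ → ℝ) (b : ℕ → Fin k → Bool)
    (bh : (t : ℕ) → Fin (t + 1) → Fin k → Bool) (u : ℕ → Fin p → ℝ) : Prop where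
  state_zero : x 0 = x₀
  state_succ : ∀ t, x (t + 1) = F *ᵥ x t + B *ᵥ u t + w t
  measurement : ∀ t, y t = outputRow m ⬝ᵥ x t + v t
  message : ∀ t, b t = obs.msg t (fun s => y s) (fun s => u s)
  decoded : ∀ t, bh t = decodedBits ch code b ν t
  control_zero : u 0 = ctl.init
  control_succ : ∀ t, u (t + 1) = ctl.law t fun s => bh s

/-!
The observer knows the control inputs, so it can subtract their effect from the measurements and
encode the state of the uncontrolled plant. It runs a predictor driven by quantized innovations: if
the prediction error lies in a fixed box, a quantizer with `2 ^ k` cells locates the first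
coordinate well enough for the error at the next step to lie in the same box, as soon as
`∑ |a i| < 2 ^ k` (`exists_predictionError_bound`). In closed form the rate threshold is
`(1 / n) log₂ (√m ∑ |a i| θ ^ ((i - 1) / 2))` (`rateThreshold_plantMatrix`), because the weights
`1, √θ, θ, …` are reproduced by all columns of `|F| D` but the first. As `√m` and `θ` are at least
`1`, every rate above the threshold provides enough cells (`sum_abs_lt_two_pow`).

The prediction is a linear function of the quantization levels (`predictedState_eq_linearState`).
Hence a decoder whose first wrong message is `d` steps old reconstructs it up to a multiple of
`ρ ^ d` for any `ρ > λ(F)` (`enorm_decodedState_sub_sq_le`, by Gelfand's formula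
`exists_norm_pow_mulVec_le`). The messages depend only on the initial state and the plant noises,
which are independent of the channel, so the reliability bound for fixed message sequences applies
to them (`measure_isFirstError_le`). The error has bounded second moment because
`∑ ρ ^ (2 d) 2 ^ (-n β d)` converges when `β > (2 / n) log₂ λ(F)` and `ρ` is close to `λ(F)`
(`meanSquareBounded_decodedState`).

The controller treats the increments of the decoded prediction as impulses and cancels each of them
within `m` steps, which is possible by controllability (`exists_deadbeat_gains`). The state is then
the prediction error plus a fixed linear function of the last `m` increments
(`IsClosedLoop.state_eq_error_add`), and the increments are bounded by the prediction errors and the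
process noise.
-/

/-! ### Spectral radius of a real matrix -/

/-- The powers of a matrix grow at most like `ρ ^ j` for every `ρ` above its spectral radius
(Gelfand's formula). -/
theorem exists_norm_pow_mulVec_le {m : ℕ} (A : Matrix (Fin m) (Fin m) ℝ) {ρ : ℝ}
    (h : specRad A < ρ) :
    ∃ C : ℝ, 0 ≤ C ∧ ∀ (j : ℕ) (v : Fin m → ℝ), ‖(A ^ j) *ᵥ v‖ ≤ C * ρ ^ j * ‖v‖ := by
  let _ : NormedRing (Matrix (Fin m) (Fin m) ℂ) := Matrix.linftyOpNormedRing
  let _ : NormedAlgebra ℂ (Matrix (Fin m) (Fin m) ℂ) := Matrix.linftyOpNormedAlgebra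
  let _ : NormedRing (Matrix (Fin m) (Fin m) ℝ) := Matrix.linftyOpNormedRing
  have : CompleteSpace (Matrix (Fin m) (Fin m) ℂ) := FiniteDimensional.complete ℂ _
  have hρ : 0 < ρ := lt_of_le_of_lt ENNReal.toReal_nonneg h
  set A' : Matrix (Fin m) (Fin m) ℂ := A.map (algebraMap ℝ ℂ) with hA'
  have hnorm : ∀ j, ‖A ^ j‖ = ‖A' ^ j‖ := by
    intro j
    have : A' ^ j = (A ^ j).map (algebraMap ℝ ℂ) := by
      simpa [hA'] using (map_pow (algebraMap ℝ ℂ).mapMatrix A j).symm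
    rw [this, Matrix.linfty_opNorm_def, Matrix.linfty_opNorm_def]
    simp
  have hfin : spectralRadius ℂ A' ≠ ⊤ :=
    ((spectrum.spectralRadius_le_pow_nnnorm_pow_one_div ℂ A' 0).trans_lt (by
      simp [ENNReal.mul_lt_top])).ne
  have hlt : spectralRadius ℂ A' < ENNReal.ofReal ρ := by
    rw [← ENNReal.ofReal_toReal hfin]
    exact (ENNReal.ofReal_lt_ofReal_iff hρ).2 h
  have hev := (spectrum.pow_nnnorm_pow_one_div_tendsto_nhds_spectralRadius A').eventually
    (gt_mem_nhds hlt)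
  obtain ⟨n₀, hn₀⟩ := eventually_atTop.1 hev
  have hlarge : ∀ j, max n₀ 1 ≤ j → ‖A' ^ j‖ ≤ ρ ^ j := by
    intro j hj
    have h1 := hn₀ j (le_trans (le_max_left _ _) hj)
    have hj0 : (0 : ℝ) < j := by exact_mod_cast lt_of_lt_of_le one_pos (le_trans (le_max_right _ _) hj)
    have h2 := ENNReal.rpow_le_rpow h1.le hj0.le
    rw [← ENNReal.rpow_mul, one_div, inv_mul_cancel₀ hj0.ne', ENNReal.rpow_one,
      ENNReal.rpow_natCast, ← ENNReal.ofReal_pow hρ.le] at h2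
    have h3 : ENNReal.ofReal ‖A' ^ j‖ ≤ ENNReal.ofReal (ρ ^ j) := by
      simpa [ofReal_norm, enorm_eq_nnnorm] using h2
    exact (ENNReal.ofReal_le_ofReal_iff (by positivity)).1 h3
  refine ⟨1 + ∑ i ∈ Finset.range (max n₀ 1), ‖A' ^ i‖ / ρ ^ i, by positivity, fun j v => ?_⟩
  refine (Matrix.linfty_opNorm_mulVec (A ^ j) v).trans ?_
  rw [hnorm]
  gcongr
  by_cases hj : max n₀ 1 ≤ j
  · have : 0 ≤ ∑ i ∈ Finset.range (max n₀ 1), ‖A' ^ i‖ / ρ ^ i := by positivity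
    nlinarith [hlarge j hj, pow_pos hρ j]
  · have h1 : ‖A' ^ j‖ / ρ ^ j ≤ ∑ i ∈ Finset.range (max n₀ 1), ‖A' ^ i‖ / ρ ^ i :=
      Finset.single_le_sum (f := fun i => ‖A' ^ i‖ / ρ ^ i) (fun i _ => by positivity)
        (Finset.mem_range.2 (not_le.1 hj))
    rw [div_le_iff₀ (pow_pos hρ j)] at h1
    nlinarith [pow_pos hρ j]

/-- If some positive weights make every weighted absolute column sum smaller than the weight of
the column, then the spectral radius is below `1`. -/
theorem specRad_lt_one_of_sum_lt {m : ℕ} (hm : 0 < m) (A : Matrix (Fin m) (Fin m) ℝ)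
    (p : Fin m → ℝ) (hp : ∀ i, 0 < p i) (h : ∀ j, ∑ i, p i * |A i j| < p j) :
    specRad A < 1 := by
  let _ : NormedRing (Matrix (Fin m) (Fin m) ℂ) := Matrix.linftyOpNormedRing
  let _ : NormedAlgebra ℂ (Matrix (Fin m) (Fin m) ℂ) := Matrix.linftyOpNormedAlgebra
  have : CompleteSpace (Matrix (Fin m) (Fin m) ℂ) := FiniteDimensional.complete ℂ _
  have : Nonempty (Fin m) := ⟨⟨0, hm⟩⟩
  obtain ⟨z, hz, hzr⟩ := spectrum.exists_nnnorm_eq_spectralRadius (A.map (algebraMap ℝ ℂ))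
  have hr : specRad A = ‖z‖ := by
    rw [specRad, ← hzr]; simp
  rw [hr]
  by_contra! hz1
  rw [spectrum.mem_iff, Matrix.isUnit_iff_isUnit_det, isUnit_iff_ne_zero, not_not,
    ← Matrix.exists_mulVec_eq_zero_iff] at hz
  obtain ⟨v, hv, hzv⟩ := hz
  have hrow : ∀ i, ‖z‖ * ‖v i‖ ≤ ∑ j, |A i j| * ‖v j‖ := by
    intro i
    have h1 := congrFun hzv i
    rw [Matrix.sub_mulVec, Algebra.algebraMap_eq_smul_one, Matrix.smul_mulVec, Matrix.one_mulVec,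
      Pi.sub_apply, Pi.zero_apply, sub_eq_zero, Pi.smul_apply, smul_eq_mul] at h1
    rw [← norm_mul, h1, Matrix.mulVec, dotProduct]
    refine (norm_sum_le _ _).trans (Finset.sum_le_sum fun j _ => ?_)
    simp
  have hsum : ∑ i, p i * ‖v i‖ ≤ ∑ j, (∑ i, p i * |A i j|) * ‖v j‖ := by
    calc ∑ i, p i * ‖v i‖ ≤ ∑ i, p i * ∑ j, |A i j| * ‖v j‖ := by
          refine Finset.sum_le_sum fun i _ => mul_le_mul_of_nonneg_left ?_ (hp i).le
          exact le_trans (by nlinarith [norm_nonneg (v i)]) (hrow i)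
      _ = ∑ j, (∑ i, p i * |A i j|) * ‖v j‖ := by
          simp_rw [Finset.mul_sum, Finset.sum_mul]
          rw [Finset.sum_comm]
          simp_rw [mul_assoc]
  obtain ⟨j₀, hj₀⟩ := Function.ne_iff.1 hv
  refine absurd hsum (not_le.2 (Finset.sum_lt_sum (fun j _ => ?_) ⟨j₀, Finset.mem_univ _, ?_⟩))
  · exact mul_le_mul_of_nonneg_right (h j).le (norm_nonneg _)
  · exact mul_lt_mul_of_pos_right (h j₀) (norm_pos_iff.2 hj₀)

/-- If some nonzero nonnegative weights are, in every column of a nonnegative matrix, at most the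
weighted column sum, then the powers of the matrix do not decay, so its spectral radius is at
least `1`. -/
theorem one_le_specRad_of_le_sum {m : ℕ} (A : Matrix (Fin m) (Fin m) ℝ) (hA : ∀ i j, 0 ≤ A i j)
    (p : Fin m → ℝ) (hp : ∀ i, 0 ≤ p i) (j₀ : Fin m) (hj₀ : 0 < p j₀)
    (h : ∀ j, p j ≤ ∑ i, p i * A i j) : 1 ≤ specRad A := by
  by_contra! hlt
  obtain ⟨ρ, hρ, hρ1⟩ := exists_between hlt
  have hρ0 : 0 ≤ ρ := ENNReal.toReal_nonneg.trans hρ.le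
  obtain ⟨C, -, hC⟩ := exists_norm_pow_mulVec_le A hρ
  have hpow : ∀ (n : ℕ) (j : Fin m), p j ≤ (p ᵥ* A ^ n) j := by
    intro n
    induction n with
    | zero => simp
    | succ n ih =>
      intro j
      rw [pow_succ, ← Matrix.vecMul_vecMul]
      refine (h j).trans (Finset.sum_le_sum fun i _ => ?_)
      exact mul_le_mul_of_nonneg_right (ih i) (hA i j)
  have hbd : ∀ n : ℕ, p j₀ ≤ (∑ i, p i) * (C * ρ ^ n) := by
    intro n
    refine (hpow n j₀).trans ?_
    rw [Finset.sum_mul, Matrix.vecMul, dotProduct]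
    refine Finset.sum_le_sum fun i _ => mul_le_mul_of_nonneg_left ?_ (hp i)
    have h1 := hC n (Pi.single j₀ 1)
    have h2 := norm_le_pi_norm ((A ^ n) *ᵥ Pi.single j₀ 1) i
    rw [Matrix.mulVec_single_one] at h1 h2
    refine (le_abs_self _).trans (h2.trans (h1.trans (le_of_eq ?_)))
    rw [Pi.norm_single]; simp
  have hlim : Tendsto (fun n : ℕ => (∑ i, p i) * (C * ρ ^ n)) atTop (nhds 0) := by
    simpa using ((tendsto_pow_atTop_nhds_zero_of_lt_one hρ0 hρ1).const_mul C).const_mul (∑ i, p i)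
  exact absurd (ge_of_tendsto' hlim hbd) (not_le.2 hj₀)

/-! ### The rate threshold in closed form -/

/-- Weighted column sums of the plant matrix: the first column gives a sum over the coefficients,
every other column has a single entry `1` and gives the previous weight. -/
theorem sum_weights_mul_plantMatrix {m : ℕ} (a : ℕ → ℝ) (f : ℝ → ℝ) (hf0 : f 0 = 0)
    (hf1 : f 1 = 1) (p : ℕ → ℝ) (j : Fin m) :
    ∑ i : Fin m, p i * f (plantMatrix m a i j) =
      if (j : ℕ) = 0 then ∑ i ∈ Finset.range m, p i * f (-a (i + 1)) else p ((j : ℕ) - 1) := by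
  split_ifs with hj
  · rw [← Fin.sum_univ_eq_sum_range (fun i => p i * f (-a (i + 1)))]
    simp [plantMatrix, hj]
  · rw [Finset.sum_eq_single (⟨(j : ℕ) - 1, by omega⟩ : Fin m)]
    · have : (j : ℕ) = (j : ℕ) - 1 + 1 := by omega
      simp [plantMatrix, hj, ← this, hf1]
    · intro i _ hi
      have : (j : ℕ) ≠ i + 1 := fun h => hi (Fin.ext (by simp [h]))
      simp [plantMatrix, hj, this, hf0]
    · simp

/-- The first column of `F · diag(q, s, …, s)` enters through `∑ |a i| s ^ (i - 1)` only: the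
weights `1, t, t², …` with `t` slightly above `s` certify that the spectral radius is below
`1`. -/
theorem specRad_plantMatrix_mul_diagonal_lt_one {m : ℕ} (hm : 0 < m) (a : ℕ → ℝ) {q s : ℝ}
    (hq : 0 ≤ q) (hs : 0 < s)
    (h : q * ∑ i ∈ Finset.range m, |a (i + 1)| * s ^ i < 1) :
    specRad (plantMatrix m a * Matrix.diagonal fun i : Fin m => if (i : ℕ) = 0 then q else s) < 1 := by
  have hcont : Continuous fun t : ℝ => q * ∑ i ∈ Finset.range m, |a (i + 1)| * t ^ i := by fun_prop
  obtain ⟨t, hst, ht⟩ : ∃ t, s < t ∧ q * ∑ i ∈ Finset.range m, |a (i + 1)| * t ^ i < 1 := by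
    have h1 := (hcont.tendsto s).eventually (gt_mem_nhds h)
    have h2 : ∀ᶠ t in nhdsWithin s (Set.Ioi s), s < t := self_mem_nhdsWithin
    exact (h2.and (h1.filter_mono nhdsWithin_le_nhds)).exists
  have ht0 : 0 < t := hs.trans hst
  refine specRad_lt_one_of_sum_lt hm _ (fun i => t ^ (i : ℕ)) (fun i => by positivity) fun j => ?_
  have hcol : ∀ i : Fin m, t ^ (i : ℕ) * |(plantMatrix m a * Matrix.diagonal
      fun i : Fin m => if (i : ℕ) = 0 then q else s) i j| =
      (t ^ (i : ℕ) * |plantMatrix m a i j|) * (if (j : ℕ) = 0 then q else s) := by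
    intro i
    rw [Matrix.mul_diagonal, abs_mul, abs_of_nonneg (a := if (j : ℕ) = 0 then q else s)
      (by split_ifs <;> positivity), mul_assoc]
  simp_rw [hcol]
  rw [← Finset.sum_mul, sum_weights_mul_plantMatrix a (fun x => |x|) abs_zero abs_one
    (fun i => t ^ i) j]
  split_ifs with hj
  · rw [hj, pow_zero, mul_comm]
    simpa [mul_comm] using ht
  · obtain ⟨l, hl⟩ := Nat.exists_eq_succ_of_ne_zero hj
    rw [hl, Nat.succ_sub_one, pow_succ]
    exact mul_lt_mul_of_pos_left hst (by positivity)

theorem one_le_specRad_absMatrix_plantMatrix_mul_diagonal {m : ℕ} (hm : 0 < m) (a : ℕ → ℝ)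
    {q s : ℝ} (hq : 0 ≤ q) (hs : 0 < s)
    (h : 1 ≤ q * ∑ i ∈ Finset.range m, |a (i + 1)| * s ^ i) :
    1 ≤ specRad (absMatrix (plantMatrix m a) *
      Matrix.diagonal fun i : Fin m => if (i : ℕ) = 0 then q else s) := by
  refine one_le_specRad_of_le_sum _ (fun i j => ?_) (fun i => s ^ (i : ℕ))
    (fun i => by positivity) ⟨0, hm⟩ (by simp) fun j => ?_
  · rw [Matrix.mul_diagonal, absMatrix, Matrix.map_apply]
    split_ifs <;> positivity
  have hcol : ∀ i : Fin m, s ^ (i : ℕ) * (absMatrix (plantMatrix m a) * Matrix.diagonal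
      fun i : Fin m => if (i : ℕ) = 0 then q else s) i j =
      (s ^ (i : ℕ) * |plantMatrix m a i j|) * (if (j : ℕ) = 0 then q else s) := by
    intro i
    rw [Matrix.mul_diagonal, absMatrix, Matrix.map_apply, mul_assoc]
  simp_rw [hcol]
  rw [← Finset.sum_mul, sum_weights_mul_plantMatrix a (fun x => |x|) abs_zero abs_one
    (fun i => s ^ i) j]
  split_ifs with hj
  · rw [hj, pow_zero, mul_comm]
    simpa [mul_comm] using h
  · obtain ⟨l, hl⟩ := Nat.exists_eq_succ_of_ne_zero hj
    rw [hl, Nat.succ_sub_one, pow_succ]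

theorem absMatrix_plantMatrix (m : ℕ) (a : ℕ → ℝ) :
    absMatrix (plantMatrix m a) = plantMatrix m fun i => -|a i| := by
  ext i j
  simp only [absMatrix, plantMatrix, Matrix.map_apply, Matrix.of_apply]
  split_ifs <;> simp

/-- An unstable plant matrix has a nonzero coefficient: more precisely the absolute values of its
coefficients add up to at least `1`. -/
theorem one_le_sum_abs_of_one_lt_specRad {m : ℕ} (hm : 0 < m) (a : ℕ → ℝ)
    (hF : 1 < specRad (plantMatrix m a)) : 1 ≤ ∑ i ∈ Finset.range m, |a (i + 1)| := by
  by_contra! h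
  have := specRad_plantMatrix_mul_diagonal_lt_one hm a (q := 1) (s := 1) zero_le_one one_pos
    (by simpa using h)
  simp only [ite_self, Matrix.diagonal_one, mul_one] at this
  exact absurd this (not_lt.2 hF.le)

theorem one_le_theta {m : ℕ} (hm : 2 ≤ m) : 1 ≤ theta m := by
  have : (2 : ℝ) ≤ m := by exact_mod_cast hm
  rw [theta, le_div_iff₀ (by linarith)]
  linarith

/-- `∑ |a i| θ ^ ((i - 1) / 2)`; the rate threshold is `(1 / n) log₂` of `√m` times this number. -/
noncomputable def weightedCoeffSum (m : ℕ) (a : ℕ → ℝ) : ℝ :=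
  ∑ i ∈ Finset.range m, |a (i + 1)| * √(theta m) ^ i

theorem sum_abs_le_weightedCoeffSum {m : ℕ} (hm : 2 ≤ m) (a : ℕ → ℝ) :
    ∑ i ∈ Finset.range m, |a (i + 1)| ≤ weightedCoeffSum m a :=
  Finset.sum_le_sum fun _ _ => le_mul_of_one_le_right (abs_nonneg _)
    (one_le_pow₀ (Real.one_le_sqrt.2 (one_le_theta hm)))

theorem mem_admissibleRates_iff {m n : ℕ} (hm : 2 ≤ m) (a : ℕ → ℝ) (r : ℝ) :
    r ∈ admissibleRates n (plantMatrix m a) ↔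
      √(m : ℝ) * (2 : ℝ) ^ (-((n : ℝ) * r)) * weightedCoeffSum m a < 1 := by
  have hs : 0 < √(theta m) := Real.sqrt_pos.2 (by linarith [one_le_theta hm])
  have hq : 0 ≤ √(m : ℝ) * (2 : ℝ) ^ (-((n : ℝ) * r)) := by positivity
  refine ⟨fun h => ?_, fun h => ?_⟩
  · by_contra! hle
    exact absurd h (not_lt.2
      (one_le_specRad_absMatrix_plantMatrix_mul_diagonal (by omega) a hq hs hle))
  · change specRad _ < 1
    rw [absMatrix_plantMatrix]
    exact specRad_plantMatrix_mul_diagonal_lt_one (by omega) _ hq hs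
      (by simpa [weightedCoeffSum] using h)

theorem admissibleRates_plantMatrix {m n : ℕ} (hm : 2 ≤ m) (hn : 0 < n) (a : ℕ → ℝ)
    (hF : 1 < specRad (plantMatrix m a)) :
    admissibleRates n (plantMatrix m a) =
      Set.Ioi (1 / (n : ℝ) * Real.logb 2 (√(m : ℝ) * weightedCoeffSum m a)) := by
  have hS : 0 < √(m : ℝ) * weightedCoeffSum m a :=
    mul_pos (Real.sqrt_pos.2 (by exact_mod_cast (by omega : 0 < m)))
      (by linarith [one_le_sum_abs_of_one_lt_specRad (by omega) a hF,
        sum_abs_le_weightedCoeffSum hm a])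
  have hn' : (0 : ℝ) < n := by exact_mod_cast hn
  ext r
  rw [mem_admissibleRates_iff hm, Set.mem_Ioi, one_div, inv_mul_lt_iff₀ hn',
    Real.logb_lt_iff_lt_rpow one_lt_two hS, mul_right_comm, Real.rpow_neg zero_le_two,
    ← div_eq_mul_inv, div_lt_one (by positivity)]

theorem rateThreshold_plantMatrix {m n : ℕ} (hm : 2 ≤ m) (hn : 0 < n) (a : ℕ → ℝ)
    (hF : 1 < specRad (plantMatrix m a)) :
    rateThreshold n (plantMatrix m a) =
      1 / (n : ℝ) * Real.logb 2 (√(m : ℝ) * weightedCoeffSum m a) := by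
  rw [rateThreshold, admissibleRates_plantMatrix hm hn a hF, csInf_Ioi]

/-- Above the rate threshold, the number of messages exceeds the sum of the absolute coefficients,
which is what an interval filter needs. -/
theorem sum_abs_lt_two_pow {m n k : ℕ} (hm : 2 ≤ m) (hn : 0 < n) (a : ℕ → ℝ)
    (hF : 1 < specRad (plantMatrix m a)) {R : ℝ} (hR : rateThreshold n (plantMatrix m a) < R)
    (hk : (k : ℝ) = n * R) : ∑ i ∈ Finset.range m, |a (i + 1)| < 2 ^ k := by
  have hmem : R ∈ admissibleRates n (plantMatrix m a) := by
    rw [admissibleRates_plantMatrix hm hn a hF, Set.mem_Ioi]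
    rwa [rateThreshold_plantMatrix hm hn a hF] at hR
  rw [mem_admissibleRates_iff hm, ← hk, Real.rpow_neg zero_le_two, Real.rpow_natCast,
    mul_right_comm, ← div_eq_mul_inv, div_lt_one (by positivity)] at hmem
  have hm1 : 1 ≤ √(m : ℝ) := Real.one_le_sqrt.2 (by exact_mod_cast (by omega : 1 ≤ m))
  have h1 := sum_abs_le_weightedCoeffSum hm a
  have h0 : 0 ≤ ∑ i ∈ Finset.range m, |a (i + 1)| := by positivity
  nlinarith

/-- The weights `1/2, 1/4, …, 2^{-(m-1)}, 2^{-(m-1)}` add up to `1`, so the weighted sum of the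
coefficients is at most the maximum. -/
theorem weightedCoeffSum_le {m : ℕ} (hm : 2 ≤ m) (a : ℕ → ℝ) :
    weightedCoeffSum m a ≤ max (|a m| * (2 * theta m) ^ (m - 1))
      (⨆ i : Fin (m - 1), 2 * |a (i + 1)| * (2 * theta m) ^ (i : ℕ)) := by
  set M := max (|a m| * (2 * theta m) ^ (m - 1))
      (⨆ i : Fin (m - 1), 2 * |a (i + 1)| * (2 * theta m) ^ (i : ℕ)) with hM
  have hθ := one_le_theta hm
  have hsθ : √(theta m) ≤ theta m := Real.sqrt_le_left (by linarith) |>.2 (by nlinarith)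
  have hle : ∀ i : ℕ, |a (i + 1)| * √(theta m) ^ i ≤ |a (i + 1)| * theta m ^ i := fun i => by
    gcongr
  have hi : ∀ i ∈ Finset.range (m - 1), |a (i + 1)| * √(theta m) ^ i ≤ M * (1 / 2) ^ (i + 1) := by
    intro i hi
    have h1 : 2 * |a (i + 1)| * (2 * theta m) ^ i ≤ M :=
      (le_ciSup (f := fun i : Fin (m - 1) => 2 * |a (i + 1)| * (2 * theta m) ^ (i : ℕ))
        (Set.finite_range _).bddAbove ⟨i, Finset.mem_range.1 hi⟩).trans (le_max_right _ _)
    refine (hle i).trans ?_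
    rw [one_div, inv_pow, ← div_eq_mul_inv, le_div_iff₀ (by positivity)]
    refine le_trans (le_of_eq ?_) h1
    rw [mul_pow, pow_succ]; ring
  have hlast : |a (m - 1 + 1)| * √(theta m) ^ (m - 1) ≤ M * (1 / 2) ^ (m - 1) := by
    have h1 : |a m| * (2 * theta m) ^ (m - 1) ≤ M := le_max_left _ _
    refine (hle _).trans ?_
    rw [one_div, inv_pow, ← div_eq_mul_inv, le_div_iff₀ (by positivity),
      Nat.sub_add_cancel (by omega)]
    refine le_trans (le_of_eq ?_) h1
    rw [mul_pow]; ring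
  have hgeom : ∀ l : ℕ, ∑ i ∈ Finset.range l, M * (1 / 2 : ℝ) ^ (i + 1) + M * (1 / 2) ^ l = M := by
    intro l
    induction l with
    | zero => simp
    | succ l ih => rw [Finset.sum_range_succ]; linear_combination ih
  have hsplit : weightedCoeffSum m a = ∑ i ∈ Finset.range (m - 1), |a (i + 1)| * √(theta m) ^ i +
      |a (m - 1 + 1)| * √(theta m) ^ (m - 1) := by
    rw [weightedCoeffSum, ← Finset.sum_range_succ, Nat.sub_add_cancel (by omega)]
  rw [hsplit, ← hgeom (m - 1)]
  exact add_le_add (Finset.sum_le_sum hi) hlast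

theorem rateThreshold_plantMatrix_le {m n : ℕ} (hm : 2 ≤ m) (hn : 0 < n) (a : ℕ → ℝ)
    (hF : 1 < specRad (plantMatrix m a)) :
    rateThreshold n (plantMatrix m a) ≤
      1 / (2 * (n : ℝ)) * Real.logb 2 m +
        1 / (n : ℝ) * Real.logb 2
          (max (|a m| * (2 * theta m) ^ (m - 1))
            (⨆ i : Fin (m - 1), 2 * |a (i + 1)| * (2 * theta m) ^ (i : ℕ))) := by
  have hS : 0 < weightedCoeffSum m a := by
    linarith [one_le_sum_abs_of_one_lt_specRad (by omega) a hF, sum_abs_le_weightedCoeffSum hm a]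
  have hm0 : (0 : ℝ) < m := by exact_mod_cast (by omega : 0 < m)
  have hn' : (0 : ℝ) < n := by exact_mod_cast hn
  rw [rateThreshold_plantMatrix hm hn a hF,
    Real.logb_mul (Real.sqrt_pos.2 hm0).ne' hS.ne', mul_add]
  refine add_le_add (le_of_eq ?_) (mul_le_mul_of_nonneg_left ?_ (by positivity))
  · rw [Real.logb, Real.log_sqrt hm0.le, Real.logb]
    field_simp
  · exact Real.logb_le_logb_of_le one_lt_two hS (weightedCoeffSum_le hm a)

/-! ### Linear recursions -/

/-- The state at time `t` of `x (t + 1) = F x t + f t` with `x 0 = z`. -/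
def linearState {m : ℕ} (F : Matrix (Fin m) (Fin m) ℝ) (z : Fin m → ℝ) (f : ℕ → Fin m → ℝ) :
    ℕ → Fin m → ℝ
  | 0 => z
  | t + 1 => F *ᵥ linearState F z f t + f t

section LinearState

variable {m : ℕ} (F : Matrix (Fin m) (Fin m) ℝ)

theorem linearState_congr (z : Fin m → ℝ) {f g : ℕ → Fin m → ℝ} {t : ℕ}
    (h : ∀ s < t, f s = g s) : linearState F z f t = linearState F z g t := by
  induction t with
  | zero => rfl
  | succ t ih =>
    rw [linearState, linearState, ih fun s hs => h s (by omega), h t (by omega)]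

theorem linearState_add (z z' : Fin m → ℝ) (f g : ℕ → Fin m → ℝ) (t : ℕ) :
    linearState F (z + z') (fun s => f s + g s) t = linearState F z f t + linearState F z' g t := by
  induction t with
  | zero => rfl
  | succ t ih =>
    simp only [linearState, ih, Matrix.mulVec_add]
    abel

/-- Two recursions that agree up to time `t₀` and whose forcing terms stay within distance `D`
separate at most like `ρ ^ j`, where `ρ` is a growth rate of the powers of `F`. -/
theorem norm_linearState_sub_le {C ρ D : ℝ} (hρ : 1 < ρ)
    (hF : ∀ (j : ℕ) (v : Fin m → ℝ), ‖(F ^ j) *ᵥ v‖ ≤ C * ρ ^ j * ‖v‖) (hC : 0 ≤ C)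
    (z : Fin m → ℝ) {f g : ℕ → Fin m → ℝ} (hD : ∀ s, ‖f s - g s‖ ≤ D) {t₀ : ℕ}
    (h : ∀ s < t₀, f s = g s) (j : ℕ) :
    ‖linearState F z f (t₀ + j) - linearState F z g (t₀ + j)‖ ≤ C * D / (ρ - 1) * ρ ^ j := by
  have hρ' : 0 < ρ - 1 := by linarith
  have hD0 : 0 ≤ D := (norm_nonneg _).trans (hD 0)
  have key : ∀ l, ‖(F ^ l) *ᵥ (linearState F z f (t₀ + j) - linearState F z g (t₀ + j))‖ ≤
      C * D / (ρ - 1) * (ρ ^ (l + j) - ρ ^ l) := by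
    induction j with
    | zero => intro l; simp [linearState_congr F z h]
    | succ j ih =>
      intro l
      have hstep : (F ^ l) *ᵥ (linearState F z f (t₀ + (j + 1)) -
            linearState F z g (t₀ + (j + 1))) =
          (F ^ (l + 1)) *ᵥ (linearState F z f (t₀ + j) - linearState F z g (t₀ + j)) +
            (F ^ l) *ᵥ (f (t₀ + j) - g (t₀ + j)) := by
        rw [← add_assoc, linearState, linearState, pow_succ, ← Matrix.mulVec_mulVec,
          ← Matrix.mulVec_add]
        congr 1
        rw [Matrix.mulVec_sub]
        abel
      rw [hstep]
      refine (norm_add_le _ _).trans ((add_le_add (ih (l + 1))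
        ((hF l _).trans (mul_le_mul_of_nonneg_left (hD _) (by positivity)))).trans (le_of_eq ?_))
      field_simp
      ring
  have h0 := key 0
  rw [pow_zero, Matrix.one_mulVec] at h0
  refine h0.trans (mul_le_mul_of_nonneg_left ?_ (by positivity))
  simp

theorem measurable_mulVec {p : ℕ} (A : Matrix (Fin m) (Fin p) ℝ) :
    Measurable fun v : Fin p → ℝ => A *ᵥ v :=
  (continuous_const.matrix_mulVec continuous_id).measurable

theorem measurable_dotProduct_left (h : Fin m → ℝ) : Measurable fun v : Fin m → ℝ => h ⬝ᵥ v :=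
  (continuous_const.dotProduct continuous_id).measurable

theorem measurable_linearState {α : Type*} [MeasurableSpace α] {z : α → Fin m → ℝ}
    {f : α → ℕ → Fin m → ℝ} (hz : Measurable z) (hf : ∀ s, Measurable fun ω => f ω s) (t : ℕ) :
    Measurable fun ω => linearState F (z ω) (f ω) t := by
  induction t with
  | zero => exact hz
  | succ t ih => exact ((measurable_mulVec F).comp ih).add (hf t)

end LinearState

/-! ### Quantized innovations -/

/-- A uniform quantizer with `M` cells on `[-L, L]`. -/
theorem exists_quantizer {M : ℕ} (hM : 0 < M) {L : ℝ} (hL : 0 < L) :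
    ∃ (quant : ℝ → Fin M) (level : Fin M → ℝ), Measurable quant ∧ (∀ i, |level i| ≤ L) ∧
      ∀ z, |z| ≤ L → |z - level (quant z)| ≤ L / M := by
  have hM' : (0 : ℝ) < M := by exact_mod_cast hM
  refine ⟨fun z => ⟨min ⌊(z + L) * M / (2 * L)⌋₊ (M - 1), by omega⟩,
    fun i => -L + (2 * (i : ℕ) + 1) * L / M, ?_, fun i => ?_, fun z hz => ?_⟩
  · have h1 : Measurable fun z : ℝ => ⌊(z + L) * M / (2 * L)⌋₊ :=
      Nat.measurable_floor.comp (by fun_prop)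
    exact (measurable_of_countable fun j : ℕ => (⟨min j (M - 1), by omega⟩ : Fin M)).comp h1
  · have hi : ((i : ℕ) : ℝ) + 1 ≤ M := by exact_mod_cast i.2
    have h1 : (2 * ((i : ℕ) : ℝ) + 1) * L / M ≤ 2 * L := by
      rw [div_le_iff₀ hM']; nlinarith
    have h2 : 0 ≤ (2 * ((i : ℕ) : ℝ) + 1) * L / M := by positivity
    exact abs_le.2 ⟨by linarith, by linarith⟩
  · obtain ⟨hz1, hz2⟩ := abs_le.1 hz
    set y := (z + L) * M / (2 * L) with hy
    have hy0 : 0 ≤ y := div_nonneg (mul_nonneg (by linarith) hM'.le) (by linarith)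
    have hyM : y ≤ M := by
      rw [hy, div_le_iff₀ (by linarith)]; nlinarith
    have hzy : z = 2 * L * y / M - L := by
      rw [hy]; field_simp; ring
    have hj1 : ((min ⌊y⌋₊ (M - 1) : ℕ) : ℝ) ≤ y :=
      le_trans (by exact_mod_cast min_le_left _ _) (Nat.floor_le hy0)
    have hj2 : y ≤ ((min ⌊y⌋₊ (M - 1) : ℕ) : ℝ) + 1 := by
      rcases le_total ⌊y⌋₊ (M - 1) with h | h
      · rw [min_eq_left h]; exact (Nat.lt_floor_add_one y).le
      · rw [min_eq_right h, Nat.cast_sub hM]; simpa using hyM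
    set j : ℝ := ((min ⌊y⌋₊ (M - 1) : ℕ) : ℝ)
    have hdiff : z - (-L + (2 * j + 1) * L / M) = L / M * (2 * (y - j) - 1) := by
      rw [hzy]; field_simp; ring
    change |z - (-L + (2 * j + 1) * L / M)| ≤ L / M
    rw [hdiff, abs_mul, abs_of_pos (div_pos hL hM')]
    exact mul_le_of_le_one_right (by positivity) (abs_le.2 ⟨by linarith, by linarith⟩)

section Predictor

variable {m : ℕ} {β : Type*} (F : Matrix (Fin m) (Fin m) ℝ) (h : Fin m → ℝ) (quant : ℝ → β)
  (level : β → ℝ)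

/-- The one-step prediction of the state of the uncontrolled plant from quantized innovations:
the innovation `y t - h · x̂ t` is replaced by the level of its quantization cell, which corrects
the measured coordinate of the prediction before it is propagated by `F`. -/
def predictedState (y : ℕ → ℝ) : ℕ → Fin m → ℝ
  | 0 => 0
  | t + 1 => F *ᵥ predictedState y t + level (quant (y t - h ⬝ᵥ predictedState y t)) • (F *ᵥ h)

/-- The quantized innovation at time `t`. -/
def quantizedInnovation (y : ℕ → ℝ) (t : ℕ) : β :=
  quant (y t - h ⬝ᵥ predictedState F h quant level y t)

/-- The forcing term of the predictor determined by a sequence of quantized innovations. -/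
def levelForcing (b : ℕ → β) (t : ℕ) : Fin m → ℝ := level (b t) • (F *ᵥ h)

/-- The prediction is a linear function of the levels of the quantized innovations. -/
theorem predictedState_eq_linearState (y : ℕ → ℝ) (t : ℕ) :
    predictedState F h quant level y t =
      linearState F 0 (levelForcing F h level (quantizedInnovation F h quant level y)) t := by
  induction t with
  | zero => rfl
  | succ t ih => rw [predictedState, linearState, ih, levelForcing, quantizedInnovation, ih]

theorem predictedState_congr {y y' : ℕ → ℝ} {t : ℕ} (hy : ∀ s < t, y s = y' s) :
    predictedState F h quant level y t = predictedState F h quant level y' t := by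
  induction t with
  | zero => rfl
  | succ t ih =>
    rw [predictedState, predictedState, ih fun s hs => hy s (by omega), hy t (by omega)]

theorem quantizedInnovation_congr {y y' : ℕ → ℝ} {t : ℕ} (hy : ∀ s ≤ t, y s = y' s) :
    quantizedInnovation F h quant level y t = quantizedInnovation F h quant level y' t := by
  rw [quantizedInnovation, quantizedInnovation, hy t le_rfl,
    predictedState_congr F h quant level fun s hs => hy s hs.le]

variable [MeasurableSpace β] [DiscreteMeasurableSpace β]

theorem measurable_predictedState {α : Type*} [MeasurableSpace α] {y : α → ℕ → ℝ}
    (hq : Measurable quant) (hy : ∀ s, Measurable fun ω => y ω s) (t : ℕ) :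
    Measurable fun ω => predictedState F h quant level (y ω) t := by
  induction t with
  | zero => exact measurable_const
  | succ t ih =>
    refine ((measurable_mulVec F).comp ih).add (Measurable.smul_const ?_ _)
    exact (Measurable.of_discrete (f := level)).comp
      (hq.comp ((hy t).sub ((measurable_dotProduct_left h).comp ih)))

theorem measurable_quantizedInnovation {α : Type*} [MeasurableSpace α] {y : α → ℕ → ℝ}
    (hq : Measurable quant) (hy : ∀ s, Measurable fun ω => y ω s) (t : ℕ) :
    Measurable fun ω => quantizedInnovation F h quant level (y ω) t :=
  hq.comp ((hy t).sub
    ((measurable_dotProduct_left h).comp (measurable_predictedState F h quant level hq hy t)))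

end Predictor

/-! ### The prediction error of the plant stays in a box -/

theorem outputRow_dotProduct {m : ℕ} (hm : 0 < m) (v : Fin m → ℝ) :
    outputRow m ⬝ᵥ v = v ⟨0, hm⟩ := by
  rw [dotProduct, Finset.sum_eq_single ⟨0, hm⟩]
  · simp [outputRow]
  · intro j _ hj
    have : (j : ℕ) ≠ 0 := fun h => hj (Fin.ext h)
    simp [outputRow, this]
  · simp

theorem plantMatrix_mulVec {m : ℕ} (hm : 0 < m) (a : ℕ → ℝ) (v : Fin m → ℝ) (i : Fin m) :
    (plantMatrix m a *ᵥ v) i =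
      -a (i + 1) * v ⟨0, hm⟩ + if h : (i : ℕ) + 1 < m then v ⟨i + 1, h⟩ else 0 := by
  have hsplit : ∀ j : Fin m, plantMatrix m a i j * v j =
      (if j = ⟨0, hm⟩ then -a (i + 1) * v j else 0) +
        (if (j : ℕ) = i + 1 then v j else 0) := by
    intro j
    have h0 : j = ⟨0, hm⟩ ↔ (j : ℕ) = 0 := Fin.ext_iff
    simp only [plantMatrix, Matrix.of_apply, h0]
    split_ifs <;> first | omega | simp
  rw [Matrix.mulVec, dotProduct, Finset.sum_congr rfl fun j _ => hsplit j, Finset.sum_add_distrib]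
  congr 1
  · simp
  · split_ifs with h
    · rw [Finset.sum_eq_single ⟨i + 1, h⟩]
      · simp
      · intro j _ hj
        rw [if_neg fun h' => hj (Fin.ext h')]
      · simp
    · exact Finset.sum_eq_zero fun j _ => if_neg (by omega)

/-- If the quantizer has more than `∑ |a i|` cells, the prediction error of the plant never leaves
a fixed box, whatever the bounded disturbances are. The range `L` of the quantizer is the bound on
the innovations, and the half-widths `Δ i` of the box solve
`Δ i = |a (i + 1)| δ + Δ (i + 1) + N`, where `δ` bounds the error of the first coordinate after
the correction by the quantized innovation. -/
theorem exists_predictionError_bound {m M : ℕ} (hm : 0 < m) (a : ℕ → ℝ)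
    (hM : ∑ i ∈ Finset.range m, |a (i + 1)| < M) {N V : ℝ} (hN : 0 ≤ N) (hV : 0 < V) :
    ∃ L : ℝ, 0 < L ∧ ∃ D : ℝ, ∀ {β : Type} (quant : ℝ → β) (level : β → ℝ),
      (∀ z, |z| ≤ L → |z - level (quant z)| ≤ L / M) →
      ∀ (x₀ : Fin m → ℝ) (w : ℕ → Fin m → ℝ) (v : ℕ → ℝ), ‖x₀‖ ≤ N → (∀ t, ‖w t‖ ≤ N) →
        (∀ t, |v t| ≤ V) → ∀ t,
        ‖linearState (plantMatrix m a) x₀ w t -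
          predictedState (plantMatrix m a) (outputRow m) quant level
            (fun s => outputRow m ⬝ᵥ linearState (plantMatrix m a) x₀ w s + v s) t‖ ≤ D := by
  set A := ∑ i ∈ Finset.range m, |a (i + 1)| with hA
  have hA0 : 0 ≤ A := by positivity
  have hM0 : (0 : ℝ) < M := hA0.trans_lt hM
  set δ : ℝ := (m * N + V + M * V) / (M - A) with hδ
  have hδ0 : 0 ≤ δ := div_nonneg (by positivity) (by linarith)
  set Δ : ℕ → ℝ := fun i => (∑ j ∈ Finset.Ico i m, |a (j + 1)|) * δ + ((m : ℝ) - i) * N with hΔ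
  have hΔ0 : Δ 0 = A * δ + m * N := by simp [hΔ, hA]
  have hΔnn : ∀ i ≤ m, 0 ≤ Δ i := by
    intro i hi
    have : (i : ℝ) ≤ m := by exact_mod_cast hi
    have h2 : 0 ≤ ((m : ℝ) - i) * N := mul_nonneg (by linarith) hN
    positivity
  have hΔrec : ∀ i < m, Δ i = |a (i + 1)| * δ + Δ (i + 1) + N := by
    intro i hi
    simp only [hΔ]
    rw [Finset.sum_eq_sum_Ico_succ_bot hi]
    push_cast
    ring
  have hΔN : ∀ i < m, N ≤ Δ i := fun i hi => by
    have h1 := hΔnn (i + 1) hi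
    have h2 : 0 ≤ |a (i + 1)| * δ := by positivity
    linarith [hΔrec i hi]
  have hfix : (Δ 0 + V) / M + V = δ := by
    have hMA : (M : ℝ) - A ≠ 0 := by linarith
    rw [hΔ0, hδ]
    field_simp
    ring
  refine ⟨Δ 0 + V, by linarith [hΔnn 0 (by omega)], Δ 0, ?_⟩
  intro β quant level hq x₀ w v hx₀ hw hv t
  have hΔle : ∀ i ≤ m, Δ i ≤ Δ 0 := by
    intro i hi
    induction i with
    | zero => exact le_rfl
    | succ i ih =>
      have h2 : 0 ≤ |a (i + 1)| * δ := by positivity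
      linarith [hΔrec i hi, ih (by omega)]
  suffices hbox : ∀ i : Fin m, |(linearState (plantMatrix m a) x₀ w t -
      predictedState (plantMatrix m a) (outputRow m) quant level
        (fun s => outputRow m ⬝ᵥ linearState (plantMatrix m a) x₀ w s + v s) t) i| ≤ Δ i from
    (pi_norm_le_iff_of_nonneg (hΔnn 0 (by omega))).2 fun i =>
      (hbox i).trans (hΔle i i.2.le)
  induction t with
  | zero =>
    intro i
    simp only [linearState, predictedState, sub_zero]
    exact ((norm_le_pi_norm x₀ i).trans hx₀).trans (hΔN i i.2)
  | succ t ih =>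
    intro i
    rw [linearState, predictedState]
    set ξ := linearState (plantMatrix m a) x₀ w t with hξ
    set ξ' := predictedState (plantMatrix m a) (outputRow m) quant level
        (fun s => outputRow m ⬝ᵥ linearState (plantMatrix m a) x₀ w s + v s) t with hξ'
    set e := ξ - ξ' with he
    set z := outputRow m ⬝ᵥ ξ + v t - outputRow m ⬝ᵥ ξ' with hz
    have hze : z = e ⟨0, hm⟩ + v t := by
      rw [hz, outputRow_dotProduct hm, outputRow_dotProduct hm, he, Pi.sub_apply]; ring
    have hzL : |z| ≤ Δ 0 + V := by
      rw [hze]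
      exact (abs_add_le _ _).trans (add_le_add (ih ⟨0, hm⟩) (hv t))
    have hr : |e ⟨0, hm⟩ - level (quant z)| ≤ δ := by
      rw [← hfix]
      have h1 : e ⟨0, hm⟩ - level (quant z) = (z - level (quant z)) - v t := by rw [hze]; ring
      rw [h1]
      exact (abs_sub _ _).trans (add_le_add (hq z hzL) (hv t))
    have hstep : plantMatrix m a *ᵥ ξ + w t -
        (plantMatrix m a *ᵥ ξ' + level (quant z) • plantMatrix m a *ᵥ outputRow m) =
        plantMatrix m a *ᵥ (e - level (quant z) • outputRow m) + w t := by
      rw [Matrix.mulVec_sub, he, Matrix.mulVec_sub, Matrix.mulVec_smul]; abel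
    rw [hstep, Pi.add_apply, plantMatrix_mulVec hm]
    have h0 : (e - level (quant z) • outputRow m) ⟨0, hm⟩ = e ⟨0, hm⟩ - level (quant z) := by
      simp [outputRow]
    have h1 : |if h : (i : ℕ) + 1 < m then (e - level (quant z) • outputRow m) ⟨i + 1, h⟩ else 0| ≤
        Δ (i + 1) := by
      split_ifs with h
      · have := ih ⟨i + 1, h⟩
        simpa [outputRow] using this
      · simpa using hΔnn (i + 1) i.2
    have h2 : |w t i| ≤ N := (norm_le_pi_norm (w t) i).trans (hw t)
    rw [h0, hΔrec i i.2]
    refine (abs_add_le _ _).trans (add_le_add ((abs_add_le _ _).trans (add_le_add ?_ h1)) h2)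
    rw [abs_mul, abs_neg]
    exact mul_le_mul_of_nonneg_left hr (abs_nonneg _)

/-! ### Deadbeat compensation of innovations -/

/-- Controllability lets the inputs of `m` consecutive steps cancel any state: with
`L 0 = 1` the response to a unit innovation and `G i` the feedback gain `i` steps after it,
the compensated response `L` vanishes after `m` steps. -/
theorem exists_deadbeat_gains {m p : ℕ} (F : Matrix (Fin m) (Fin m) ℝ)
    (B : Matrix (Fin m) (Fin p) ℝ) (hFB : IsControllable F B) :
    ∃ (G : ℕ → Matrix (Fin p) (Fin m) ℝ) (L : ℕ → Matrix (Fin m) (Fin m) ℝ),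
      L 0 = 1 ∧ (∀ i, L (i + 1) = F * L i - B * G i) ∧ L m = 0 := by
  set K : Matrix (Fin m) (Fin m × Fin p) ℝ :=
    Matrix.of fun (i : Fin m) (j : Fin m × Fin p) => (F ^ (j.1 : ℕ) * B) i j.2 with hK
  have hsurj : Function.Surjective K.mulVec := by
    have hrank : K.rank = m := hFB
    have : LinearMap.range K.mulVecLin = ⊤ :=
      Submodule.eq_top_of_finrank_eq (by rw [← Matrix.rank, hrank]; simp)
    exact LinearMap.range_eq_top.1 this
  obtain ⟨J, hJ⟩ := Matrix.mulVec_surjective_iff_exists_right_inverse.1 hsurj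
  set Q := J * F ^ m with hQ
  set g : ℕ → Matrix (Fin p) (Fin m) ℝ := fun i =>
    Matrix.of fun l c => if hi : i < m then Q (⟨i, hi⟩, l) c else 0 with hg
  have hsum : ∑ i ∈ Finset.range m, F ^ i * B * g i = F ^ m := by
    have h1 : K * Q = F ^ m := by rw [hQ, ← Matrix.mul_assoc, hJ, Matrix.one_mul]
    rw [← h1, ← Fin.sum_univ_eq_sum_range (fun i => F ^ i * B * g i)]
    ext r c
    rw [Matrix.sum_apply, Matrix.mul_apply, Fintype.sum_prod_type]
    refine Finset.sum_congr rfl fun i _ => ?_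
    rw [Matrix.mul_apply]
    simp [hg, hK]
  let G : ℕ → Matrix (Fin p) (Fin m) ℝ := fun i => g (m - 1 - i)
  let L : ℕ → Matrix (Fin m) (Fin m) ℝ := fun i =>
    Nat.rec 1 (fun i Li => F * Li - B * G i) i
  have hL : ∀ i, L (i + 1) = F * L i - B * G i := fun i => rfl
  refine ⟨G, L, rfl, hL, ?_⟩
  have hform : ∀ l, L l = F ^ l - ∑ i ∈ Finset.range l, F ^ (l - 1 - i) * B * G i := by
    intro l
    induction l with
    | zero => simp [L]
    | succ l ih =>
      rw [hL, ih, Matrix.mul_sub, ← pow_succ', Finset.sum_range_succ, Finset.mul_sum, sub_sub]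
      congr 2
      · refine Finset.sum_congr rfl fun i hi => ?_
        have : l + 1 - 1 - i = l - 1 - i + 1 := by have := Finset.mem_range.1 hi; omega
        rw [this, pow_succ', Matrix.mul_assoc, Matrix.mul_assoc, Matrix.mul_assoc]
      · simp
  rw [hform, sub_eq_zero, ← Finset.sum_range_reflect]
  rw [← hsum]
  refine Finset.sum_congr rfl fun i hi => ?_
  have : m - 1 - (m - 1 - i) = i := by have := Finset.mem_range.1 hi; omega
  simp only [G, this]

section Compensation

variable {m p : ℕ} (F : Matrix (Fin m) (Fin m) ℝ) (B : Matrix (Fin m) (Fin p) ℝ)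
  (G : ℕ → Matrix (Fin p) (Fin m) ℝ)

/-- The increments `ζ (t + 1) - F ζ t` of a sequence of state estimates, with initial value
`ζ 0`. -/
def estimateInnovation (ζ : ℕ → Fin m → ℝ) : ℕ → Fin m → ℝ
  | 0 => ζ 0
  | t + 1 => ζ (t + 1) - F *ᵥ ζ t

/-- The control input that compensates the last `m` innovations with the gains `G`. -/
def compensatingControl (ζ : ℕ → Fin m → ℝ) (t : ℕ) : Fin p → ℝ :=
  -∑ i ∈ Finset.range m, if i ≤ t then G i *ᵥ estimateInnovation F ζ (t - i) else 0

theorem compensatingControl_congr {ζ ζ' : ℕ → Fin m → ℝ} {t : ℕ} (h : ∀ s ≤ t, ζ s = ζ' s) :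
    compensatingControl F G ζ t = compensatingControl F G ζ' t := by
  have hδ : ∀ s ≤ t, estimateInnovation F ζ s = estimateInnovation F ζ' s := by
    intro s hs
    cases s with
    | zero => exact h 0 hs
    | succ s => rw [estimateInnovation, estimateInnovation, h _ hs, h s (by omega)]
  unfold compensatingControl
  congr 1
  refine Finset.sum_congr rfl fun i _ => ?_
  rw [hδ (t - i) (by omega)]

/-- Under deadbeat gains, the estimate plus the response to the control inputs depends on the last
`m` innovations only. -/
theorem add_linearState_compensatingControl (hm : 0 < m) {L : ℕ → Matrix (Fin m) (Fin m) ℝ}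
    (hL0 : L 0 = 1) (hL : ∀ i, L (i + 1) = F * L i - B * G i) (hLm : L m = 0)
    (ζ : ℕ → Fin m → ℝ) (t : ℕ) :
    ζ t + linearState F 0 (fun s => B *ᵥ compensatingControl F G ζ s) t =
      ∑ i ∈ Finset.range m, if i ≤ t then L i *ᵥ estimateInnovation F ζ (t - i) else 0 := by
  induction t with
  | zero =>
    rw [Finset.sum_eq_single 0]
    · simp [linearState, hL0, estimateInnovation]
    · intro i _ hi
      rw [if_neg (by omega)]
    · intro h; exact absurd (Finset.mem_range.2 hm) h
  | succ t ih =>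
    have h1 : ζ (t + 1) + linearState F 0 (fun s => B *ᵥ compensatingControl F G ζ s) (t + 1) =
        estimateInnovation F ζ (t + 1) +
          (F *ᵥ (ζ t + linearState F 0 (fun s => B *ᵥ compensatingControl F G ζ s) t) +
            B *ᵥ compensatingControl F G ζ t) := by
      rw [linearState, estimateInnovation, Matrix.mulVec_add]; abel
    have h2 : ∑ i ∈ Finset.range m, (if i ≤ t + 1 then
          L i *ᵥ estimateInnovation F ζ (t + 1 - i) else 0) =
        ∑ i ∈ Finset.range (m + 1), (if i ≤ t + 1 then
          L i *ᵥ estimateInnovation F ζ (t + 1 - i) else 0) := by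
      rw [Finset.sum_range_succ, hLm]; simp
    rw [h1, h2, ih, Finset.sum_range_succ', compensatingControl, Matrix.mulVec_neg,
      ← sub_eq_add_neg, ← Matrix.mulVecLin_apply F, ← Matrix.mulVecLin_apply B, map_sum, map_sum,
      ← Finset.sum_sub_distrib, add_comm]
    congr 1
    · refine Finset.sum_congr rfl fun i _ => ?_
      by_cases hi : i ≤ t
      · rw [if_pos hi, if_pos hi, if_pos (by omega), Matrix.mulVecLin_apply,
          Matrix.mulVecLin_apply, hL, Matrix.sub_mulVec, ← Matrix.mulVec_mulVec,
          ← Matrix.mulVec_mulVec, Nat.add_sub_add_right]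
      · rw [if_neg hi, if_neg hi, if_neg (by omega)]; simp
    · simp [hL0]

end Compensation

/-! ### Decoding errors -/

/-- The first difference between the estimates `bt 0, …, bt t` and the sequence `b` is at
time `s`. -/
def IsFirstError {β : Type*} {t : ℕ} (bt : Fin (t + 1) → β) (b : ℕ → β) (s : ℕ) : Prop :=
  IsLeast {τ : ℕ | ∃ h : τ < t + 1, bt ⟨τ, h⟩ ≠ b τ} s

section DecodedState

variable {m : ℕ} {β : Type*} (F : Matrix (Fin m) (Fin m) ℝ) (h : Fin m → ℝ) (level : β → ℝ)

/-- The state prediction computed from the estimates of the messages: at time `t + 1` the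
predictor is rerun from time `0` on the estimates available at time `t`. The values of the
estimates at indices beyond `t`, filled in by `Fin.ofNat`, do not matter. -/
def decodedState (bh : (s : ℕ) → Fin (s + 1) → β) : ℕ → Fin m → ℝ
  | 0 => 0
  | t + 1 => linearState F 0 (levelForcing F h level fun s => bh t (Fin.ofNat (t + 1) s)) (t + 1)

theorem decodedState_congr {bh bh' : (s : ℕ) → Fin (s + 1) → β} {t : ℕ}
    (hb : ∀ s < t, bh s = bh' s) : decodedState F h level bh t = decodedState F h level bh' t := by
  cases t with
  | zero => rfl
  | succ t => rw [decodedState, decodedState, hb t (by omega)]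

open Classical in
/-- A decoding error whose first occurrence is `d` steps old costs at most a multiple of `ρ ^ d` in
the state prediction. -/
theorem enorm_decodedState_sub_sq_le {C ρ L : ℝ} (hρ : 1 < ρ) (hC : 0 ≤ C)
    (hF : ∀ (j : ℕ) (v : Fin m → ℝ), ‖(F ^ j) *ᵥ v‖ ≤ C * ρ ^ j * ‖v‖)
    (hL : ∀ i, |level i| ≤ L) (bh : (s : ℕ) → Fin (s + 1) → β) (b : ℕ → β) (t : ℕ) :
    ‖linearState F 0 (levelForcing F h level b) (t + 1) - decodedState F h level bh (t + 1)‖ₑ ^ 2 ≤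
      ∑ d ∈ Finset.Icc 1 (t + 1), if IsFirstError (bh t) b (t + 1 - d) then
        ENNReal.ofReal ((C * (2 * L * ‖F *ᵥ h‖) / (ρ - 1) * ρ ^ d) ^ 2) else 0 := by
  set b' : ℕ → β := fun s => bh t (Fin.ofNat (t + 1) s) with hb'
  have hb't : ∀ s (hs : s < t + 1), b' s = bh t ⟨s, hs⟩ := fun s hs =>
    congrArg (bh t) (Fin.ext (Nat.mod_eq_of_lt hs))
  rw [decodedState]
  have hdiff : ∀ s, ‖levelForcing F h level b s - levelForcing F h level b' s‖ ≤
      2 * L * ‖F *ᵥ h‖ := by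
    intro s
    rw [levelForcing, levelForcing, ← sub_smul, norm_smul, Real.norm_eq_abs]
    refine mul_le_mul_of_nonneg_right ?_ (norm_nonneg _)
    exact (abs_sub _ _).trans (by linarith [hL (b s), hL (b' s)])
  by_cases hex : ∃ τ, ∃ hτ : τ < t + 1, bh t ⟨τ, hτ⟩ ≠ b τ
  · obtain ⟨hs, -⟩ := Nat.find_spec hex
    set s := Nat.find hex
    have hfirst : IsFirstError (bh t) b s := ⟨Nat.find_spec hex, fun τ hτ => Nat.find_min' hex hτ⟩
    have hagree : ∀ r < s, levelForcing F h level b r = levelForcing F h level b' r := by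
      intro r hr
      have := Nat.find_min hex hr
      push Not at this
      rw [levelForcing, levelForcing, hb't r (by omega), this (by omega)]
    have hbound := norm_linearState_sub_le F hρ hF hC 0 hdiff hagree (t + 1 - s)
    rw [Nat.add_sub_cancel' hs.le] at hbound
    refine le_trans ?_ (Finset.single_le_sum (fun _ _ => zero_le)
      (Finset.mem_Icc.2 ⟨by omega, by omega⟩ : t + 1 - s ∈ Finset.Icc 1 (t + 1)))
    rw [Nat.sub_sub_self hs.le, if_pos hfirst, ← ofReal_norm,
      ← ENNReal.ofReal_pow (norm_nonneg _)]
    exact ENNReal.ofReal_le_ofReal (pow_le_pow_left₀ (norm_nonneg _) hbound 2)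
  · push Not at hex
    rw [linearState_congr F 0 (g := levelForcing F h level b') fun s hs => by
      rw [levelForcing, levelForcing, hb't s hs, hex s hs]]
    change ‖_ - linearState F 0 (levelForcing F h level b') (t + 1)‖ₑ ^ 2 ≤ _
    rw [sub_self]
    simp

end DecodedState

section Channel

variable {n k : ℕ} {Z N : Type*} [MeasurableSpace Z] [MeasurableSpace N]

theorem measurable_decodedBits (ch : Channel n Z N) (code : CausalCode n k Z) (t : ℕ) :
    Measurable fun q : (ℕ → Fin k → Bool) × N => decodedBits ch code q.1 q.2 t := by
  refine (code.measurable_dec t).comp (measurable_pi_lambda _ fun s => ?_)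
  have h1 : Measurable fun q : N × (Fin ((s : ℕ) + 1) → Fin n → Bool) => ch.out s q.2 q.1 :=
    measurable_from_prod_countable_left fun c => ch.measurable_out s c
  have h2 : Measurable fun b : ℕ → Fin k → Bool =>
      fun (r : Fin ((s : ℕ) + 1)) => code.enc r fun q => b q := by
    refine measurable_pi_lambda _ fun r => ?_
    exact (Measurable.of_discrete (f := code.enc r)).comp
      (measurable_pi_lambda _ fun q => measurable_pi_apply _)
  exact h1.comp (measurable_snd.prodMk (h2.comp measurable_fst))

theorem measurableSet_isFirstError (ch : Channel n Z N) (code : CausalCode n k Z) (t s : ℕ) :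
    MeasurableSet {q : (ℕ → Fin k → Bool) × N | IsFirstError (decodedBits ch code q.1 q.2 t) q.1 s} := by
  have h1 : Measurable fun q : (ℕ → Fin k → Bool) × N =>
      (decodedBits ch code q.1 q.2 t, fun r : Fin (t + 1) => q.1 r) :=
    (measurable_decodedBits ch code t).prodMk
      (measurable_pi_lambda _ fun r => (measurable_pi_apply _).comp measurable_fst)
  exact h1 (MeasurableSet.of_discrete (s := {q : (Fin (t + 1) → Fin k → Bool) ×
    (Fin (t + 1) → Fin k → Bool) | IsLeast {τ : ℕ | ∃ h : τ < t + 1, q.1 ⟨τ, h⟩ ≠ q.2 ⟨τ, h⟩} s}))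

/-- A bound on the probability of a decoding error that holds for every fixed message sequence
holds for random messages as well, as long as they are independent of the channel noise. -/
theorem measure_isFirstError_le (ch : Channel n Z N) (code : CausalCode n k Z) {Ω Θ : Type*}
    [MeasurableSpace Ω] [MeasurableSpace Θ] (μ : Measure Ω) [IsProbabilityMeasure μ]
    {ν : Ω → N} {θ : Ω → Θ} (hν : Measurable ν) (hθ : Measurable θ) (hmap : μ.map ν = ch.noise)
    (hind : IndepFun ν θ μ) {Φ : Θ → ℕ → Fin k → Bool} (hΦ : ∀ t, Measurable fun ϑ => Φ ϑ t)
    (t s : ℕ) {c : ENNReal}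
    (hc : ∀ b, ch.noise {ν | IsFirstError (decodedBits ch code b ν t) b s} ≤ c) :
    MeasurableSet {ω | IsFirstError (decodedBits ch code (Φ (θ ω)) (ν ω) t) (Φ (θ ω)) s} ∧
      μ {ω | IsFirstError (decodedBits ch code (Φ (θ ω)) (ν ω) t) (Φ (θ ω)) s} ≤ c := by
  have hS : MeasurableSet {q : N × Θ | IsFirstError (decodedBits ch code (Φ q.2) q.1 t) (Φ q.2) s} :=
    (((measurable_pi_lambda _ hΦ).comp measurable_snd).prodMk measurable_fst)
      (measurableSet_isFirstError ch code t s)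
  refine ⟨(hν.prodMk hθ) hS, ?_⟩
  have : IsProbabilityMeasure (μ.map θ) := Measure.isProbabilityMeasure_map hθ.aemeasurable
  have : IsProbabilityMeasure (μ.map ν) := Measure.isProbabilityMeasure_map hν.aemeasurable
  have h1 := Measure.map_apply (μ := μ) (hν.prodMk hθ) hS
  rw [(indepFun_iff_map_prod_eq_prod_map_map hν.aemeasurable hθ.aemeasurable).1 hind,
    Measure.prod_apply_symm hS] at h1
  refine (le_of_eq h1.symm).trans ?_
  calc ∫⁻ ϑ, (μ.map ν) ((fun ν => (ν, ϑ)) ⁻¹' _) ∂(μ.map θ) ≤ ∫⁻ _, c ∂(μ.map θ) := by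
        refine lintegral_mono fun ϑ => ?_
        rw [hmap]
        exact hc (Φ ϑ)
    _ = c := by simp

/-- The tail bound of an anytime reliable code, extended to all delays `d`. -/
theorem IsAnytimeReliable.exists_bound {ch : Channel n Z N} {code : CausalCode n k Z} {R β : ℝ}
    (h : IsAnytimeReliable ch code R β) (hγ : (2 : ℝ) ^ (-((n : ℝ) * β)) ≤ 1) :
    ∃ H : ℝ, 0 ≤ H ∧ ∀ (t d : ℕ), d ≤ t + 1 → ∀ b : ℕ → Fin k → Bool,
      ch.noise {ν | IsFirstError (decodedBits ch code b ν t) b (t + 1 - d)} ≤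
        ENNReal.ofReal (H * ((2 : ℝ) ^ (-((n : ℝ) * β))) ^ d) := by
  obtain ⟨-, d₀, -, η, hη, hbd⟩ := h
  set γ := (2 : ℝ) ^ (-((n : ℝ) * β)) with hγdef
  have hγ0 : 0 < γ := by positivity
  refine ⟨max η (γ ^ d₀)⁻¹, hη.le.trans (le_max_left _ _), fun t d hd b => ?_⟩
  by_cases hd₀ : d₀ ≤ d
  · refine (hbd b t d hd₀ hd).trans (ENNReal.ofReal_le_ofReal ?_)
    have hpow : (2 : ℝ) ^ (-((n : ℝ) * β * d)) = γ ^ d := by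
      rw [hγdef, ← Real.rpow_mul_natCast zero_le_two, neg_mul]
    rw [hpow]
    gcongr
    exact le_max_left _ _
  · have := ch.isProbabilityMeasure
    refine prob_le_one.trans ?_
    rw [← ENNReal.ofReal_one]
    refine ENNReal.ofReal_le_ofReal ?_
    calc (1 : ℝ) = (γ ^ d₀)⁻¹ * γ ^ d₀ := by field_simp
      _ ≤ max η (γ ^ d₀)⁻¹ * γ ^ d :=
        mul_le_mul (le_max_right _ _) (pow_le_pow_of_le_one hγ0.le hγ (by omega))
          (by positivity) (by positivity)

end Channel

/-! ### Mean-square boundedness -/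

/-- The squared norms of the random vectors `f t` have, uniformly in `t`, bounded expectations.
They are only asked to be dominated by measurable functions with bounded integrals, so that no
measurability of `f` is needed. -/
def MeanSquareBounded {Ω : Type*} [MeasurableSpace Ω] (μ : Measure Ω) {m : ℕ}
    (f : ℕ → Ω → Fin m → ℝ) : Prop :=
  ∃ g : ℕ → Ω → ENNReal, (∀ t, Measurable (g t)) ∧ (∀ t, ∀ᵐ ω ∂μ, ‖f t ω‖ₑ ^ 2 ≤ g t ω) ∧
    ∃ C : ENNReal, C ≠ ⊤ ∧ ∀ t, ∫⁻ ω, g t ω ∂μ ≤ C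

namespace MeanSquareBounded

variable {Ω : Type*} [MeasurableSpace Ω] {μ : Measure Ω} {m : ℕ} {f g : ℕ → Ω → Fin m → ℝ}

theorem of_forall_norm_le [IsProbabilityMeasure μ] {D : ℝ} (h : ∀ t, ∀ᵐ ω ∂μ, ‖f t ω‖ ≤ D) :
    MeanSquareBounded μ f := by
  refine ⟨fun _ _ => ENNReal.ofReal D ^ 2, fun _ => measurable_const, fun t => ?_,
    ENNReal.ofReal D ^ 2, by finiteness, fun t => by simp⟩
  filter_upwards [h t] with ω hω
  rw [← ofReal_norm]
  gcongr

theorem add (hf : MeanSquareBounded μ f) (hg : MeanSquareBounded μ g) :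
    MeanSquareBounded μ fun t ω => f t ω + g t ω := by
  obtain ⟨F, hFm, hF, C, hC, hFC⟩ := hf
  obtain ⟨G, hGm, hG, D, hD, hGD⟩ := hg
  refine ⟨fun t ω => 2 * (F t ω + G t ω), fun t => ((hFm t).add (hGm t)).const_mul 2, fun t => ?_,
    2 * (C + D), by finiteness, fun t => ?_⟩
  · filter_upwards [hF t, hG t] with ω h1 h2
    calc ‖f t ω + g t ω‖ₑ ^ 2 ≤ (‖f t ω‖ₑ + ‖g t ω‖ₑ) ^ 2 := by
          gcongr; exact enorm_add_le _ _
      _ ≤ 2 * (‖f t ω‖ₑ ^ 2 + ‖g t ω‖ₑ ^ 2) := by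
          have := ENNReal.rpow_add_le_mul_rpow_add_rpow ‖f t ω‖ₑ ‖g t ω‖ₑ (p := 2) one_le_two
          norm_num at this
          exact this
      _ ≤ 2 * (F t ω + G t ω) := by gcongr
  · change ∫⁻ ω, 2 * (F t ω + G t ω) ∂μ ≤ _
    rw [lintegral_const_mul 2 (f := fun ω => F t ω + G t ω) ((hFm t).add (hGm t)),
      lintegral_add_left (hFm t)]
    gcongr
    · exact hFC t
    · exact hGD t

theorem of_norm_le (hg : MeanSquareBounded μ g) (K : ℝ)
    (h : ∀ t ω, ‖f t ω‖ ≤ K * ‖g t ω‖) : MeanSquareBounded μ f := by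
  obtain ⟨G, hGm, hG, D, hD, hGD⟩ := hg
  refine ⟨fun t ω => ENNReal.ofReal |K| ^ 2 * G t ω, fun t => (hGm t).const_mul _, fun t => ?_,
    ENNReal.ofReal |K| ^ 2 * D, by finiteness, fun t => ?_⟩
  · filter_upwards [hG t] with ω h2
    calc ‖f t ω‖ₑ ^ 2 ≤ (ENNReal.ofReal |K| * ‖g t ω‖ₑ) ^ 2 := by
          rw [← ofReal_norm, ← ofReal_norm, ← ENNReal.ofReal_mul (abs_nonneg K)]
          gcongr
          exact (h t ω).trans (mul_le_mul_of_nonneg_right (le_abs_self K) (norm_nonneg _))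
      _ = ENNReal.ofReal |K| ^ 2 * ‖g t ω‖ₑ ^ 2 := mul_pow _ _ _
      _ ≤ _ := by gcongr
  · rw [lintegral_const_mul _ (hGm t)]
    gcongr
    exact hGD t

theorem mulVec (hf : MeanSquareBounded μ f) (A : Matrix (Fin m) (Fin m) ℝ) :
    MeanSquareBounded μ fun t ω => A *ᵥ f t ω := by
  let _ : NormedRing (Matrix (Fin m) (Fin m) ℝ) := Matrix.linftyOpNormedRing
  exact hf.of_norm_le ‖A‖ fun t ω => Matrix.linfty_opNorm_mulVec A _

/-- Boundedness is inherited by a sequence delayed by `i` steps. -/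
theorem delay (hf : MeanSquareBounded μ f) (i : ℕ) :
    MeanSquareBounded μ fun t ω => if i ≤ t then f (t - i) ω else 0 := by
  obtain ⟨F, hFm, hF, C, hC, hFC⟩ := hf
  refine ⟨fun t => F (t - i), fun t => hFm _, fun t => ?_, C, hC, fun t => hFC _⟩
  filter_upwards [hF (t - i)] with ω hω
  split_ifs
  · exact hω
  · simp

theorem sum [IsProbabilityMeasure μ] {ι : Type*} (s : Finset ι) {f : ι → ℕ → Ω → Fin m → ℝ}
    (hf : ∀ i ∈ s, MeanSquareBounded μ (f i)) :
    MeanSquareBounded μ fun t ω => ∑ i ∈ s, f i t ω := by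
  classical
  induction s using Finset.induction_on with
  | empty => exact of_forall_norm_le (D := 0) fun t => by simp
  | insert i s hi ih =>
    simp_rw [Finset.sum_insert hi]
    exact (hf i (Finset.mem_insert_self i s)).add
      (ih fun j hj => hf j (Finset.mem_insert_of_mem hj))

theorem limsup_lt_top (hf : MeanSquareBounded μ f) :
    limsup (fun t => ∫⁻ ω, ENNReal.ofReal (f t ω ⬝ᵥ f t ω) ∂μ) atTop < ⊤ := by
  obtain ⟨F, hFm, hF, C, hC, hFC⟩ := hf
  refine lt_of_le_of_lt (b := (m : ENNReal) * C) ?_ (by finiteness)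
  refine Filter.limsup_le_of_le (h := Eventually.of_forall fun t => ?_)
  calc ∫⁻ ω, ENNReal.ofReal (f t ω ⬝ᵥ f t ω) ∂μ ≤ ∫⁻ ω, m * F t ω ∂μ := by
        refine lintegral_mono_ae ?_
        filter_upwards [hF t] with ω hω
        have h1 : f t ω ⬝ᵥ f t ω ≤ m * ‖f t ω‖ ^ 2 := by
          calc f t ω ⬝ᵥ f t ω ≤ ∑ _i : Fin m, ‖f t ω‖ ^ 2 := by
                refine Finset.sum_le_sum fun i _ => ?_
                rw [← sq, ← sq_abs]
                exact pow_le_pow_left₀ (abs_nonneg _) (norm_le_pi_norm (f t ω) i) 2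
            _ = m * ‖f t ω‖ ^ 2 := by simp
        refine (ENNReal.ofReal_le_ofReal h1).trans ?_
        rw [ENNReal.ofReal_mul (by positivity), ENNReal.ofReal_natCast,
          ENNReal.ofReal_pow (norm_nonneg _), ofReal_norm]
        gcongr
    _ = m * ∫⁻ ω, F t ω ∂μ := lintegral_const_mul _ (hFm t)
    _ ≤ m * C := by gcongr; exact hFC t

end MeanSquareBounded

/-- The prediction from decoded messages is mean-square close to the prediction from the true
messages: the cost `ρ ^ (2 d)` of a decoding error of age `d` is beaten by its probability
`γ ^ d`. -/
theorem meanSquareBounded_decodedState {m n k : ℕ} {Z N Ω Θ : Type*} [MeasurableSpace Z]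
    [MeasurableSpace N] [MeasurableSpace Ω] [MeasurableSpace Θ] (F : Matrix (Fin m) (Fin m) ℝ)
    (h : Fin m → ℝ) (level : (Fin k → Bool) → ℝ) {ch : Channel n Z N} {code : CausalCode n k Z}
    {R β : ℝ} (hcode : IsAnytimeReliable ch code R β) {C ρ L : ℝ} (hρ : 1 < ρ) (hC : 0 ≤ C)
    (hF : ∀ (j : ℕ) (v : Fin m → ℝ), ‖(F ^ j) *ᵥ v‖ ≤ C * ρ ^ j * ‖v‖)
    (hρβ : ρ ^ 2 * (2 : ℝ) ^ (-((n : ℝ) * β)) < 1) (hL : ∀ i, |level i| ≤ L)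
    (μ : Measure Ω) [IsProbabilityMeasure μ] {ν : Ω → N} {θ : Ω → Θ} (hν : Measurable ν)
    (hθ : Measurable θ) (hmap : μ.map ν = ch.noise) (hind : IndepFun ν θ μ)
    {Φ : Θ → ℕ → Fin k → Bool} (hΦ : ∀ t, Measurable fun ϑ => Φ ϑ t) :
    MeanSquareBounded μ fun t ω => linearState F 0 (levelForcing F h level (Φ (θ ω))) t -
      decodedState F h level (decodedBits ch code (Φ (θ ω)) (ν ω)) t := by
  classical
  set γ := (2 : ℝ) ^ (-((n : ℝ) * β)) with hγ
  have hγ0 : 0 < γ := by positivity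
  have hγ1 : γ ≤ 1 := by nlinarith
  obtain ⟨H, hH, hbd⟩ := hcode.exists_bound hγ1
  set K := C * (2 * L * ‖F *ᵥ h‖) / (ρ - 1) with hK
  set E : ℕ → ℕ → Set Ω := fun t d =>
    {ω | IsFirstError (decodedBits ch code (Φ (θ ω)) (ν ω) t) (Φ (θ ω)) (t + 1 - d)} with hE
  have hmeas : ∀ t d, d ≤ t + 1 → MeasurableSet (E t d) ∧ μ (E t d) ≤ ENNReal.ofReal (H * γ ^ d) :=
    fun t d hd => measure_isFirstError_le ch code μ hν hθ hmap hind hΦ t (t + 1 - d) (hbd t d hd)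
  let g : ℕ → Ω → ENNReal := fun t => Nat.casesOn t (fun _ => 0) fun t ω =>
    ∑ d ∈ Finset.Icc 1 (t + 1), (E t d).indicator (fun _ => ENNReal.ofReal ((K * ρ ^ d) ^ 2)) ω
  have hg : ∀ t d, d ∈ Finset.Icc 1 (t + 1) → Measurable
      ((E t d).indicator fun _ => ENNReal.ofReal ((K * ρ ^ d) ^ 2)) := fun t d hd =>
    measurable_const.indicator (hmeas t d (Finset.mem_Icc.1 hd).2).1
  refine ⟨g, fun t => ?_, fun t => Eventually.of_forall fun ω => ?_,
    ENNReal.ofReal (K ^ 2 * H * (1 - ρ ^ 2 * γ)⁻¹), ENNReal.ofReal_ne_top, fun t => ?_⟩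
  · cases t with
    | zero => exact measurable_const
    | succ t => exact Finset.measurable_fun_sum _ (hg t)
  · cases t with
    | zero => simp [linearState, decodedState]
    | succ t =>
      refine (enorm_decodedState_sub_sq_le F h level hρ hC hF hL _ _ t).trans (le_of_eq ?_)
      simp only [g, Set.indicator_apply, hE, Set.mem_ofPred_eq, ← hK]
  · cases t with
    | zero => simp [g]
    | succ t =>
      have hx0 : 0 ≤ ρ ^ 2 * γ := by positivity
      calc ∫⁻ ω, g (t + 1) ω ∂μ
          = ∑ d ∈ Finset.Icc 1 (t + 1), ENNReal.ofReal ((K * ρ ^ d) ^ 2) * μ (E t d) := by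
            simp only [g]
            rw [lintegral_finsetSum _ (hg t)]
            exact Finset.sum_congr rfl fun d hd =>
              lintegral_indicator_const (hmeas t d (Finset.mem_Icc.1 hd).2).1 _
        _ ≤ ∑ d ∈ Finset.Icc 1 (t + 1), ENNReal.ofReal (K ^ 2 * H * (ρ ^ 2 * γ) ^ d) := by
            refine Finset.sum_le_sum fun d hd => ?_
            refine (mul_le_mul_right (hmeas t d (Finset.mem_Icc.1 hd).2).2 _).trans (le_of_eq ?_)
            rw [← ENNReal.ofReal_mul (by positivity)]
            congr 1
            rw [mul_pow (ρ ^ 2)]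
            ring
        _ = ENNReal.ofReal (∑ d ∈ Finset.Icc 1 (t + 1), K ^ 2 * H * (ρ ^ 2 * γ) ^ d) :=
            (ENNReal.ofReal_sum_of_nonneg fun d _ => by positivity).symm
        _ ≤ ENNReal.ofReal (K ^ 2 * H * (1 - ρ ^ 2 * γ)⁻¹) := by
            refine ENNReal.ofReal_le_ofReal ?_
            rw [← Finset.mul_sum, ← tsum_geometric_of_lt_one hx0 hρβ]
            exact mul_le_mul_of_nonneg_left ((summable_geometric_of_lt_one hx0 hρβ).sum_le_tsum _
              fun d _ => pow_nonneg hx0 d) (by positivity)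

/-! ### The observer and the controller -/

section Loop

variable {m p k : ℕ} (F : Matrix (Fin m) (Fin m) ℝ) (B : Matrix (Fin m) (Fin p) ℝ)
  (h : Fin m → ℝ) (quant : ℝ → Fin k → Bool) (level : (Fin k → Bool) → ℝ)

/-- The observer subtracts the known response of the plant to the control inputs from the
measurements and sends the quantized innovations of the resulting uncontrolled plant. -/
noncomputable def innovationObserver (hq : Measurable quant) : InformedObserver p k where
  msg t Y U := quantizedInnovation F h quant level
    (fun s => (if hs : s < t + 1 then Y ⟨s, hs⟩ else 0) -
      h ⬝ᵥ linearState F 0 (fun r => if hr : r < t then B *ᵥ U ⟨r, hr⟩ else 0) s) t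
  measurable_msg t := by
    refine measurable_quantizedInnovation F h quant level hq (fun s => Measurable.sub ?_ ?_) t
    · split_ifs
      · exact (measurable_pi_apply _).comp measurable_fst
      · exact measurable_const
    · refine (measurable_dotProduct_left h).comp
        (measurable_linearState F measurable_const (fun r => ?_) s)
      split_ifs
      · exact (measurable_mulVec B).comp ((measurable_pi_apply _).comp measurable_snd)
      · exact measurable_const

/-- The controller compensates the innovations of the state predictions computed from the decoded
messages. -/
noncomputable def compensatingController (G : ℕ → Matrix (Fin p) (Fin m) ℝ) : Controller p k where
  init := 0
  law t bh := compensatingControl F G (decodedState F h level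
    fun s => if hs : s < t + 1 then bh ⟨s, hs⟩ else fun _ _ => false) (t + 1)

variable {F B h quant level} {n : ℕ} {Z N : Type*} [MeasurableSpace Z] [MeasurableSpace N]
  {ch : Channel n Z N} {code : CausalCode n k Z} {hq : Measurable quant}
  {G : ℕ → Matrix (Fin p) (Fin m) ℝ} {x₀ : Fin m → ℝ} {w : ℕ → Fin m → ℝ} {v : ℕ → ℝ} {ν : N}
  {x : ℕ → Fin m → ℝ} {y : ℕ → ℝ} {b : ℕ → Fin k → Bool}
  {bh : (t : ℕ) → Fin (t + 1) → Fin k → Bool} {u : ℕ → Fin p → ℝ}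

theorem IsClosedLoop.state_eq {obs : InformedObserver p k} {ctl : Controller p k}
    (hcl : IsClosedLoop F B ch code obs ctl x₀ w v ν x y b bh u) (t : ℕ) :
    x t = linearState F x₀ w t + linearState F 0 (fun s => B *ᵥ u s) t := by
  rw [← linearState_add, add_zero]
  induction t with
  | zero => exact hcl.state_zero
  | succ t ih =>
    rw [hcl.state_succ, linearState, ih, add_assoc, add_comm (B *ᵥ u t)]

/-- The messages do not depend on the controls, hence not on the channel. -/
theorem IsClosedLoop.message_eq {ctl : Controller p k}
    (hcl : IsClosedLoop F B ch code (innovationObserver F B (outputRow m) quant level hq) ctl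
      x₀ w v ν x y b bh u) (t : ℕ) :
    b t = quantizedInnovation F (outputRow m) quant level
      (fun s => outputRow m ⬝ᵥ linearState F x₀ w s + v s) t := by
  rw [hcl.message]
  simp only [innovationObserver]
  refine quantizedInnovation_congr F _ quant level fun s hs => ?_
  rw [dif_pos (by omega), linearState_congr F 0 (g := fun s => B *ᵥ u s) fun r hr => by
    rw [dif_pos (by omega)], hcl.measurement, hcl.state_eq, dotProduct_add]
  ring

theorem IsClosedLoop.control_eq {obs : InformedObserver p k}
    (hcl : IsClosedLoop F B ch code obs (compensatingController F h level G)
      x₀ w v ν x y b bh u) (t : ℕ) :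
    u t = compensatingControl F G (decodedState F h level bh) t := by
  cases t with
  | zero =>
    rw [hcl.control_zero, compensatingControl, Finset.sum_eq_zero, neg_zero]
    · rfl
    · intro i _
      split_ifs
      · simp [estimateInnovation, decodedState]
      · rfl
  | succ t =>
    rw [hcl.control_succ]
    refine compensatingControl_congr F G fun s hs => decodedState_congr F h level fun r hr => ?_
    rw [dif_pos (by omega)]

/-- In the closed loop the state is the prediction error plus the compensated response to the
last `m` innovations of the prediction. -/
theorem IsClosedLoop.state_eq_error_add {obs : InformedObserver p k} (hm : 0 < m)
    {L : ℕ → Matrix (Fin m) (Fin m) ℝ}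
    (hL0 : L 0 = 1) (hL : ∀ i, L (i + 1) = F * L i - B * G i) (hLm : L m = 0)
    (hcl : IsClosedLoop F B ch code obs (compensatingController F h level G)
      x₀ w v ν x y b bh u) (t : ℕ) :
    x t = (linearState F x₀ w t - decodedState F h level bh t) +
      ∑ i ∈ Finset.range m, if i ≤ t then
        L i *ᵥ estimateInnovation F (decodedState F h level bh) (t - i) else 0 := by
  rw [← add_linearState_compensatingControl F B G hm hL0 hL hLm, hcl.state_eq,
    ← funext hcl.control_eq]
  abel

end Loop

/-- If the prediction errors are mean-square bounded, so are the innovations of the prediction. -/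
theorem MeanSquareBounded.estimateInnovation {Ω : Type*} [MeasurableSpace Ω] {μ : Measure Ω}
    {m : ℕ} {F : Matrix (Fin m) (Fin m) ℝ} {x₀ : Ω → Fin m → ℝ} {w ζ : ℕ → Ω → Fin m → ℝ}
    (hζ0 : ∀ ω, ζ 0 ω = 0) (hw : MeanSquareBounded μ w)
    (he : MeanSquareBounded μ fun t ω => linearState F (x₀ ω) (fun s => w s ω) t - ζ t ω) :
    MeanSquareBounded μ fun t ω => _root_.estimateInnovation F (fun s => ζ s ω) t := by
  have hsum := ((he.of_norm_le (f := fun t ω => -(linearState F (x₀ ω) (fun s => w s ω) t - ζ t ω))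
    1 fun t ω => by rw [norm_neg, one_mul]).add (((he.mulVec F).add hw).delay 1))
  refine hsum.of_norm_le 1 fun t ω => ?_
  rw [one_mul]
  cases t with
  | zero => rw [_root_.estimateInnovation, hζ0, norm_zero]; positivity
  | succ t =>
    refine le_of_eq (congrArg _ ?_)
    rw [_root_.estimateInnovation, if_pos (by omega), Nat.add_sub_cancel, linearState,
      Matrix.mulVec_sub]
    abel

/-- Above the reliability threshold there is a growth rate `ρ` of the powers of the plant matrix
with `ρ ^ 2 < 2 ^ (n β)`. -/
theorem exists_growth_rate {l β : ℝ} {n : ℕ} (hn : 0 < n) (hl : 1 < l)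
    (hβ : 2 / (n : ℝ) * Real.logb 2 l < β) :
    ∃ ρ, l < ρ ∧ ρ ^ 2 * (2 : ℝ) ^ (-((n : ℝ) * β)) < 1 := by
  have hn' : (0 : ℝ) < n := by exact_mod_cast hn
  have h1 : Real.logb 2 l < n * β / 2 := by
    rw [div_mul_eq_mul_div, div_lt_iff₀ hn'] at hβ
    linarith
  rw [Real.logb_lt_iff_lt_rpow one_lt_two (by linarith)] at h1
  obtain ⟨ρ, hρ1, hρ2⟩ := exists_between h1
  refine ⟨ρ, hρ1, ?_⟩
  rw [Real.rpow_neg zero_le_two, ← div_eq_mul_inv, div_lt_one (by positivity)]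
  calc ρ ^ 2 < ((2 : ℝ) ^ ((n : ℝ) * β / 2)) ^ 2 := pow_lt_pow_left₀ hρ2 (by linarith) two_ne_zero
    _ = 2 ^ ((n : ℝ) * β) := by
      rw [← Real.rpow_mul_natCast zero_le_two]
      congr 1
      push_cast
      ring

theorem theorem8 {m p n : ℕ} (hm : 2 ≤ m) (hn : 0 < n) (a : ℕ → ℝ)
    (B : Matrix (Fin m) (Fin p) ℝ) (hF : 1 < specRad (plantMatrix m a)) :
    (IsControllable (plantMatrix m a) B →
      ∀ (R β : ℝ), rateThreshold n (plantMatrix m a) < R →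
        2 / (n : ℝ) * Real.logb 2 (specRad (plantMatrix m a)) < β →
      ∀ (W V X₀ : ℝ) (k : ℕ) (Z N : Type*) [MeasurableSpace Z] [MeasurableSpace N]
        (ch : Channel n Z N) (code : CausalCode n k Z), IsAnytimeReliable ch code R β →
      ∃ (obs : InformedObserver p k) (ctl : Controller p k),
        ∀ (Ω : Type*) [MeasurableSpace Ω] (μ : Measure Ω) [IsProbabilityMeasure μ]
          (x₀ : Ω → Fin m → ℝ) (w : ℕ → Ω → Fin m → ℝ) (v : ℕ → Ω → ℝ) (ν : Ω → N)
          (x : ℕ → Ω → Fin m → ℝ) (y : ℕ → Ω → ℝ) (b : ℕ → Ω → Fin k → Bool)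
          (bh : (t : ℕ) → Ω → Fin (t + 1) → Fin k → Bool) (u : ℕ → Ω → Fin p → ℝ),
          Measurable x₀ → (∀ t, Measurable (w t)) → (∀ t, Measurable (v t)) → Measurable ν →
          (∀ᵐ ω ∂μ, ‖x₀ ω‖ ≤ X₀) →
          (∀ t, ∀ᵐ ω ∂μ, ‖w t ω‖ < W / 2) →
          (∀ t, ∀ᵐ ω ∂μ, |v t ω| < V / 2) →
          μ.map ν = ch.noise →
          IndepFun ν (fun ω => (x₀ ω, (fun t => w t ω), (fun t => v t ω))) μ →
          (∀ ω, IsClosedLoop (plantMatrix m a) B ch code obs ctl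
            (x₀ ω) (fun t => w t ω) (fun t => v t ω) (ν ω)
            (fun t => x t ω) (fun t => y t ω) (fun t => b t ω) (fun t => bh t ω)
            (fun t => u t ω)) →
          limsup (fun t => ∫⁻ ω, ENNReal.ofReal (x t ω ⬝ᵥ x t ω) ∂μ) atTop < ⊤) ∧
    IsGLB (admissibleRates n (plantMatrix m a)) (rateThreshold n (plantMatrix m a)) ∧
    rateThreshold n (plantMatrix m a) ≤
      1 / (2 * (n : ℝ)) * Real.logb 2 m +
        1 / (n : ℝ) * Real.logb 2
          (max (|a m| * (2 * theta m) ^ (m - 1))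
            (⨆ i : Fin (m - 1), 2 * |a (i + 1)| * (2 * theta m) ^ (i : ℕ))) := by
  refine ⟨?_, ?_, rateThreshold_plantMatrix_le hm hn a hF⟩
  · intro hFB R β hR hβ W V X₀ k Z N _ _ ch code hcode
    have hm0 : 0 < m := by omega
    obtain ⟨G, Γ, hΓ0, hΓ, hΓm⟩ := exists_deadbeat_gains _ B hFB
    obtain ⟨ρ, hρ, hρβ⟩ := exists_growth_rate hn hF hβ
    obtain ⟨C, hC, hpow⟩ := exists_norm_pow_mulVec_le _ hρ
    have hcells := sum_abs_lt_two_pow (k := k) hm hn a hF hR hcode.1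
    obtain ⟨L, hL, D, hD⟩ := exists_predictionError_bound (M := 2 ^ k) hm0 a
      (by exact_mod_cast hcells) (N := |W| + |X₀|) (V := |V| + 1) (by positivity) (by positivity)
    obtain ⟨quant', level', hquant', hlevel', herr'⟩ :=
      exists_quantizer (M := 2 ^ k) (by positivity) hL
    -- The cells are named by the `k`-bit messages.
    let e : Fin (2 ^ k) ≃ (Fin k → Bool) := (Fintype.equivFinOfCardEq (by simp)).symm
    let quant : ℝ → Fin k → Bool := fun z => e (quant' z)
    let level : (Fin k → Bool) → ℝ := fun c => level' (e.symm c)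
    have hquant : Measurable quant := Measurable.of_discrete.comp hquant'
    have hlevel : ∀ c, |level c| ≤ L := fun c => hlevel' _
    have herr : ∀ z, |z| ≤ L → |z - level (quant z)| ≤ L / (2 ^ k : ℕ) := fun z hz => by
      simpa [level, quant] using herr' z hz
    refine ⟨innovationObserver (plantMatrix m a) B (outputRow m) quant level hquant,
      compensatingController (plantMatrix m a) (outputRow m) level G, ?_⟩
    intro Ω _ μ _ x₀ w v ν x y b bh u hx₀m hwm hvm hνm hx₀ hw hv hmap hind hcl
    -- The messages as a function of the initial state and the noises of the plant.
    let Φ : (Fin m → ℝ) × (ℕ → Fin m → ℝ) × (ℕ → ℝ) → ℕ → Fin k → Bool := fun ϑ =>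
      quantizedInnovation (plantMatrix m a) (outputRow m) quant level
        fun s => outputRow m ⬝ᵥ linearState (plantMatrix m a) ϑ.1 ϑ.2.1 s + ϑ.2.2 s
    let θ : Ω → (Fin m → ℝ) × (ℕ → Fin m → ℝ) × (ℕ → ℝ) := fun ω =>
      (x₀ ω, (fun t => w t ω), fun t => v t ω)
    have hθ : Measurable θ :=
      hx₀m.prodMk ((measurable_pi_lambda _ hwm).prodMk (measurable_pi_lambda _ hvm))
    have hΦ : ∀ t, Measurable fun ϑ => Φ ϑ t := fun t =>
      measurable_quantizedInnovation _ _ _ _ hquant (fun s =>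
        ((measurable_dotProduct_left _).comp (measurable_linearState _ measurable_fst
          (fun r => (measurable_pi_apply r).comp (measurable_fst.comp measurable_snd)) s)).add
        ((measurable_pi_apply s).comp (measurable_snd.comp measurable_snd))) t
    have hb : ∀ ω, (fun t => b t ω) = Φ (θ ω) := fun ω => funext fun t => (hcl ω).message_eq t
    have hbh : ∀ ω, (fun t => bh t ω) =
        decodedBits ch code (Φ (θ ω)) (ν ω) := fun ω => by
      rw [← hb]
      exact funext (hcl ω).decoded
    have hdec := meanSquareBounded_decodedState (plantMatrix m a) (outputRow m) level hcode
      (hF.trans hρ) hC hpow hρβ hlevel μ hνm hθ hmap hind hΦ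
    have hpred : MeanSquareBounded μ fun t ω =>
        linearState (plantMatrix m a) (x₀ ω) (fun s => w s ω) t -
          linearState (plantMatrix m a) 0
            (levelForcing (plantMatrix m a) (outputRow m) level (Φ (θ ω))) t := by
      refine MeanSquareBounded.of_forall_norm_le (D := D) fun t => ?_
      filter_upwards [hx₀, ae_all_iff.2 hw, ae_all_iff.2 hv] with ω h1 h2 h3
      rw [← predictedState_eq_linearState]
      refine hD quant level herr (x₀ ω) (fun s => w s ω) (fun s => v s ω) ?_ (fun s => ?_)
        (fun s => ?_) t
      · linarith [abs_nonneg W, le_abs_self X₀]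
      · linarith [h2 s, norm_nonneg (w s ω), abs_nonneg X₀, le_abs_self W]
      · linarith [h3 s, abs_nonneg (v s ω), le_abs_self V]
    have herror : MeanSquareBounded μ fun t ω =>
        linearState (plantMatrix m a) (x₀ ω) (fun s => w s ω) t -
          decodedState (plantMatrix m a) (outputRow m) level (fun t => bh t ω) t := by
      refine (hpred.add hdec).of_norm_le 1 fun t ω => ?_
      rw [one_mul, hbh, sub_add_sub_cancel]
    have hwb : MeanSquareBounded μ w := MeanSquareBounded.of_forall_norm_le (D := W / 2) fun t =>
      (hw t).mono fun ω hω => hω.le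
    have hinn := MeanSquareBounded.estimateInnovation (fun ω => rfl) hwb herror
    refine ((herror.add (MeanSquareBounded.sum (Finset.range m) fun i _ =>
      (hinn.mulVec (Γ i)).delay i)).of_norm_le 1 fun t ω => ?_).limsup_lt_top
    rw [one_mul, (hcl ω).state_eq_error_add hm0 hΓ0 hΓ hΓm t]
  · rw [rateThreshold_plantMatrix hm hn a hF, admissibleRates_plantMatrix hm hn a hF]
    exact isGLB_Ioi
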